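/- Work on the phase space $M=(\mathbb R^3\setminus\{0\})\times\mathbb R^3$ with coordinates $(q,p)$, Poisson bracket $\{F,G\}=\partial_qF\cdot\partial_pG-\partial_pF\cdot\partial_qG$, and put $r=|q|$, $p_r=(p\cdot q)/r$, $L=q\times p$. For real coefficients $c=(c_{l,m,n})_{l,m,n\ge 0}$ and $w\ge 0$ let $$\Lambda^{(w)}(c)=\sum_{l+m+n=w}c_{l,m,n}\,\frac{(p^2)^l(p_r^2)^n}{r^m}.$$ Consider the spherically symmetric post-Newtonian (PN) Hamiltonian, a formal series in $\epsilon$, $$H=H_0+\epsilon H_1+\epsilon^2H_2+\cdots,\qquad H_0=H_{\rm Kep}=\frac{p^2}{2}-\frac1r,\qquad H_j=\Lambda^{(j+1)}(c)\quad (j\ge 1).$$ **Definitions.** Fix $N\ge0$. * $H$ *conserves an LRL-type vector to order $N$PN* if there are smooth vector-valued functions $A_0,A_1,A_2,\dots:M\to\mathbb R^3$ with $A_0=p\times L-q/r$ and $\{H,\,A_0+\epsilon A_1+\epsilon^2A_2+\cdots\}=0$ modulo $\epsilon^{N+1}$, componentwise. * A *near-identity canonical transformation to order $N$* is given by its pullback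 on smooth functions, $\Phi^*F=F+\epsilon T_1F+\dots+\epsilon^NT_NF$, which is linear, multiplicative and compatible with the Poisson bracket modulo $\epsilon^{N+1}$, each $T_k$ mapping $C^\infty(M)$ to itself. * $H$ is *canonically conjugate to Kepler up to time reparametrization to order $N$PN* if $H=\epsilon^{-1}\,\Phi^*\tau(\epsilon H_{\rm Kep})$ modulo $\epsilon^{N+1}$ for such a $\Phi$ and a near-identity time reparametrization (a formal energy rescaling) $\tau(E)=E+\delta_1E^2+\delta_2E^3+\cdots$ with real $\delta_n$. **Theorem.** Let $N\le 5$ and let $c$ be arbitrary. Then $H$ is canonically conjugate to Kepler up to time reparametrization to order $N$PN if and only if $H$ conserves an LRL-type vector to order $N$PN. Moreover, in either condition the objects can be taken of PN form; that is, these two conditions are also equivalent to each of the following: * $H=\epsilon^{-1}\,\Phi_N^*\cdots\Phi_2^*\Phi_1^*\,\tau(\epsilon H_{\rm Kep})$ modulo $\epsilon^{N+1}$ with $\tau$ as above, where $\Phi_i^*=\exp(\epsilon^i\{G_i,\cdot\})$ and $G_i=(p\cdot q)\,\Lambda^{(i)}(a)$ for some real coefficients $a=(a_{l,m,n})$; *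 $H$ conserves, to order $N$PN, a vector with $A_0=p\times L-q/r$ and $A_j=\Lambda^{(j)}(\alpha)\,(p\cdot q)\,p+\Lambda^{(j+1)}(\beta)\,q$ for all $j\ge 0$, for some real coefficients $\alpha=(\alpha_{l,m,n})$, $\beta=(\beta_{l,m,n})$. -/

import Mathlib

open scoped ContDiff

noncomputable section

namespace PNKepler

/-- Euclidean three-space. -/
abbrev Vec : Type := EuclideanSpace ℝ (Fin 3)

/-- Pairs `(q, p)` of a position and a momentum. -/
abbrev Pt : Type := Vec × Vec

/-- The phase space `(ℝ³ ∖ {0}) × ℝ³`. -/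
def phaseSpace : Set Pt := {x | x.1 ≠ 0}

/-- Observables are functions on pairs; only their values on the phase space matter. -/
def SmoothObs (F : Pt → ℝ) : Prop := ContDiffOn ℝ ∞ F phaseSpace

/-- The canonical Poisson bracket `{F, G} = ∑ᵢ (∂F/∂qᵢ ∂G/∂pᵢ - ∂F/∂pᵢ ∂G/∂qᵢ)`. -/
def pb (F G : Pt → ℝ) (x : Pt) : ℝ :=
  ∑ i : Fin 3,
    (fderiv ℝ F x (EuclideanSpace.single i 1, 0) * fderiv ℝ G x (0, EuclideanSpace.single i 1) -
      fderiv ℝ F x (0, EuclideanSpace.single i 1) * fderiv ℝ G x (EuclideanSpace.single i 1, 0))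

/-- The radius `r = |q|`. -/
def radius (x : Pt) : ℝ := ‖x.1‖

/-- `p · q`. -/
def dotPQ (x : Pt) : ℝ := inner ℝ x.2 x.1

/-- The radial momentum `p_r = (p · q) / r`. -/
def radialMom (x : Pt) : ℝ := dotPQ x / radius x

/-- The homogeneous form
`∑ c_{l,m,n} (p²)^l (p_r²)^n / r^m`, summed over all `l, m, n ≥ 0` with `l + m + n = w`. -/
def pnForm (w : ℕ) (c : ℕ → ℕ → ℕ → ℝ) (x : Pt) : ℝ :=
  ∑ a ∈ Finset.HasAntidiagonal.antidiagonal w, ∑ b ∈ Finset.HasAntidiagonal.antidiagonal a.2,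
    c a.1 b.1 b.2 * (‖x.2‖ ^ 2) ^ a.1 * (radialMom x ^ 2) ^ b.2 / radius x ^ b.1

/-- The Kepler Hamiltonian `p²/2 - 1/r`. -/
def kepler (x : Pt) : ℝ := ‖x.2‖ ^ 2 / 2 - 1 / radius x

/-- The coefficients in `ε` of the Hamiltonian `H₀ + ε H₁ + ε² H₂ + ⋯`: `H₀` is Kepler, and
for `j ≥ 1` the term `H_j` is the general form of total degree `j + 1`. -/
def pnHam (c : ℕ → ℕ → ℕ → ℝ) : ℕ → Pt → ℝ
  | 0 => kepler
  | j + 1 => pnForm (j + 2) c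

/-- The components of the Laplace-Runge-Lenz vector `p × L - q / r`, with `L = q × p`. -/
def lrl (i : Fin 3) (x : Pt) : ℝ :=
  crossProduct (x.2 : Fin 3 → ℝ) (crossProduct (x.1 : Fin 3 → ℝ) (x.2 : Fin 3 → ℝ)) i -
    x.1 i / radius x

/-- The vector `A₀ + ε A₁ + ε² A₂ + ⋯` (with components `A j i`) Poisson commutes with the
Hamiltonian `H₀ + ε H₁ + ⋯` up to and including order `ε ^ N`. -/
def ConservedUpTo (N : ℕ) (H : ℕ → Pt → ℝ) (A : ℕ → Fin 3 → Pt → ℝ) : Prop :=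
  ∀ k ≤ N, ∀ i : Fin 3, ∀ x ∈ phaseSpace, ∑ j ∈ Finset.range (k + 1), pb (H j) (A (k - j) i) x = 0

/-- Conservation, to order `N`, of a vector with leading term `p × L - q / r` and
arbitrary smooth corrections. -/
def ConservesLRL (N : ℕ) (c : ℕ → ℕ → ℕ → ℝ) : Prop :=
  ∃ A : ℕ → Fin 3 → Pt → ℝ,
    (∀ j i, SmoothObs (A j i)) ∧
    (∀ i, Set.EqOn (A 0 i) (lrl i) phaseSpace) ∧
    ConservedUpTo N (pnHam c) A

/-- The vector field `Λ(α) (p · q) p + Λ(β) q`, with `Λ(α)` of degree `j` and `Λ(β)` of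
degree `j + 1`. -/
def pnVector (α β : ℕ → ℕ → ℕ → ℝ) (j : ℕ) (i : Fin 3) (x : Pt) : ℝ :=
  pnForm j α x * dotPQ x * x.2 i + pnForm (j + 1) β x * x.1 i

/-- As `ConservesLRL`, with all corrections of post-Newtonian form. -/
def ConservesPNLRL (N : ℕ) (c : ℕ → ℕ → ℕ → ℝ) : Prop :=
  ∃ α β : ℕ → ℕ → ℕ → ℝ,
    (∀ i, Set.EqOn (pnVector α β 0 i) (lrl i) phaseSpace) ∧
    ConservedUpTo N (pnHam c) (pnVector α β)

/-- A near-identity canonical transformation of the phase space to order `N` in `ε`, given by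
its action `Φ^* F = F + ε T₁ F + ⋯ + ε ^ N T_N F` on smooth observables: modulo `ε ^ (N + 1)`,
the pullback `Φ^*` is linear, multiplicative and preserves Poisson brackets. -/
structure IsCanonicalUpTo (N : ℕ) (T : ℕ → (Pt → ℝ) → (Pt → ℝ)) : Prop where
  smooth : ∀ k ≤ N, ∀ F, SmoothObs F → SmoothObs (T k F)
  congr : ∀ k ≤ N, ∀ F G, SmoothObs F → SmoothObs G → Set.EqOn F G phaseSpace →
    Set.EqOn (T k F) (T k G) phaseSpace
  near_id : ∀ F, SmoothObs F → Set.EqOn (T 0 F) F phaseSpace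
  map_add : ∀ k ≤ N, ∀ F G, SmoothObs F → SmoothObs G →
    Set.EqOn (T k (F + G)) (T k F + T k G) phaseSpace
  map_smul : ∀ k ≤ N, ∀ (s : ℝ) (F), SmoothObs F →
    Set.EqOn (T k (s • F)) (s • T k F) phaseSpace
  map_mul : ∀ k ≤ N, ∀ F G, SmoothObs F → SmoothObs G →
    Set.EqOn (T k (F * G)) (∑ j ∈ Finset.range (k + 1), T j F * T (k - j) G) phaseSpace
  map_pb : ∀ k ≤ N, ∀ F G, SmoothObs F → SmoothObs G →
    Set.EqOn (T k (pb F G)) (∑ j ∈ Finset.range (k + 1), pb (T j F) (T (k - j) G)) phaseSpace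

/-- With the energy rescaling `τ(E) = E + δ₁ E² + δ₂ E³ + ⋯`, the coefficients in `ε` of
`ε⁻¹ τ(ε H_Kep)`. -/
def rescaledKepler (δ : ℕ → ℝ) (n : ℕ) (x : Pt) : ℝ := δ n * kepler x ^ (n + 1)

/-- `H₀ + ε H₁ + ⋯ = ε⁻¹ Φ^* τ(ε H_Kep)` up to and including order `ε ^ N`, for some
near-identity canonical transformation `Φ` and near-identity time reparametrization `τ`. -/
def ConjugateToKepler (N : ℕ) (c : ℕ → ℕ → ℕ → ℝ) : Prop :=
  ∃ (δ : ℕ → ℝ) (T : ℕ → (Pt → ℝ) → (Pt → ℝ)),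
    δ 0 = 1 ∧ IsCanonicalUpTo N T ∧
    ∀ k ≤ N, Set.EqOn (pnHam c k)
      (∑ n ∈ Finset.range (k + 1), T (k - n) (rescaledKepler δ n)) phaseSpace

/-- The action of `exp(ε ^ i {G, ·})` on the series `F₀ + ε F₁ + ε² F₂ + ⋯` (for `i ≥ 1`):
the pullback by the time-`ε ^ i` Hamiltonian flow generated by `G`. -/
def lieTransform (i : ℕ) (G : Pt → ℝ) (F : ℕ → Pt → ℝ) (k : ℕ) : Pt → ℝ :=
  ∑ m ∈ (Finset.range (k + 1)).filter (fun m => i * m ≤ k),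
    (m.factorial : ℝ)⁻¹ • (pb G)^[m] (F (k - i * m))

/-- `Φ_n^* ⋯ Φ₂^* Φ₁^*` acting on a series, where `Φ_i^* = exp(ε ^ i {G_i, ·})`. -/
def lieChain (G : ℕ → Pt → ℝ) : ℕ → (ℕ → Pt → ℝ) → (ℕ → Pt → ℝ)
  | 0, F => F
  | n + 1, F => lieTransform (n + 1) (G (n + 1)) (lieChain G n F)

/-- The generating function `G_i = (p · q) Λ(a)`, with `Λ(a)` of degree `i`. -/
def pnGenerator (a : ℕ → ℕ → ℕ → ℝ) (i : ℕ) (x : Pt) : ℝ := dotPQ x * pnForm i a x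

/-- As `ConjugateToKepler`, with `Φ^* = Φ_N^* ⋯ Φ₁^*` the composition of the Lie transforms
with post-Newtonian generating functions. -/
def PNConjugateToKepler (N : ℕ) (c : ℕ → ℕ → ℕ → ℝ) : Prop :=
  ∃ (δ : ℕ → ℝ) (a : ℕ → ℕ → ℕ → ℝ),
    δ 0 = 1 ∧
    ∀ k ≤ N, Set.EqOn (pnHam c k) (lieChain (pnGenerator a) N (rescaledKepler δ) k) phaseSpace

end PNKepler

end

/-!
The four conditions are proved equivalent, for every order, by running around the cycle
PN-conjugate to Kepler ⟹ conjugate ⟹ conserved vector ⟹ PN-conjugate, together with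
PN-conjugate ⟹ conserved vector of PN form ⟹ conserved vector.

A chain of Lie transforms is canonical because `exp (ε ^ i {G, ·})` is an automorphism of every
bilinear operation of which `{G, ·}` is a derivation (`expSeries_conv`), in particular of the
product and, by the Jacobi identity, of the bracket. A canonical transformation pulls the
Laplace-Runge-Lenz vector back to a conserved one, since `{H_Kep, A₀} = 0`. If the generators are of
PN form, so is the pulled-back vector, as `{(p · q) g, ·}` respects the grading by weight
(`br_generator_mem`, `br_generator_mem_V`).

The substance is the step from a conserved vector to a PN-conjugation, an induction on the order
(`exists_chain_of_conserved`). Suppose `H` agrees with a transform `Φ^* τ` to order `n` and differs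
from it by `K` at order `n + 1`; `K` is a form of weight `n + 2`. With `y = p² - p_r² = L² / r²`,
the identity
`{(p · q) y ^ k r ^ (-m), H_Kep} = (2k + m) y ^ (k + 1) r ^ (-m)
  - (4k + 2m - 1) y ^ k r ^ (-m - 1) - 2 (2k + m - 1) H_Kep y ^ k r ^ (-m)`,
whose middle coefficient is odd and so never zero, removes all powers of `1 / r`: up to a total
derivative `{(p · q) g, H_Kep}`, which a further Lie transform absorbs, `K` is a combination of the
products `H_Kep ^ k y ^ (n + 2 - k)` (`mem_normalForms`). The term with `y ^ 0` is absorbed by `τ`.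
Let `Y` be the sum of the others. Pulling the conserved series back by `Φ` shows that `{Y, A₀}` is of
the form `{C, H_Kep}` with `C` smooth, so its integral over every Kepler ellipse vanishes. On the
ellipses of unit angular momentum and eccentricity `e` one has `H_Kep = (e² - 1) / 2`, and the
averages of `y ^ m` contribute integrals which do not vanish in the parabolic limit `e → 1`
(`ellipseIntegral_one_ne_zero`). Reading off the orders of vanishing at `e = 1` one after the other
gives `Y = 0` (`coeff_eq_zero_of_br_lrlObs`).
-/

noncomputable section

namespace PNKepler

/-! ### Exponentials of derivations acting on formal series -/

section Series

variable {R : Type*} [AddCommGroup R] [Module ℝ R]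

theorem sum_antidiagonal_assoc {M : Type*} [AddCommMonoid M] (k : ℕ) (f : ℕ → ℕ → ℕ → M) :
    ∑ p ∈ Finset.HasAntidiagonal.antidiagonal k,
        ∑ q ∈ Finset.HasAntidiagonal.antidiagonal p.1, f q.1 q.2 p.2 =
      ∑ p ∈ Finset.HasAntidiagonal.antidiagonal k,
        ∑ q ∈ Finset.HasAntidiagonal.antidiagonal p.2, f p.1 q.1 q.2 := by
  simp only [Finset.sum_sigma']
  refine Finset.sum_nbij' (fun x => ⟨(x.2.1, x.2.2 + x.1.2), (x.2.2, x.1.2)⟩)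
    (fun x => ⟨(x.1.1 + x.2.1, x.2.2), (x.1.1, x.2.1)⟩) ?_ ?_ ?_ ?_ ?_ <;> simp <;> grind

/-- The convolution `(F * G)_k = ∑_{a + b = k} B (F_a, G_b)` of two series with respect to a
bilinear operation `B`: this is the extension of `B` to formal series in `ε`. -/
def conv (B : R →ₗ[ℝ] R →ₗ[ℝ] R) (F G : ℕ → R) (k : ℕ) : R :=
  ∑ p ∈ Finset.HasAntidiagonal.antidiagonal k, B (F p.1) (G p.2)

/-- The operator `exp (ε ^ i D)` on formal series in `ε` (for `i ≥ 1`). -/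
def expSeries (i : ℕ) (D : Module.End ℝ R) : (ℕ → R) →ₗ[ℝ] (ℕ → R) where
  toFun F k := ∑ m ∈ (Finset.range (k + 1)).filter (fun m => i * m ≤ k),
    (m.factorial : ℝ)⁻¹ • (D ^ m) (F (k - i * m))
  map_add' F G := by
    ext k
    simp [Finset.sum_add_distrib]
  map_smul' c F := by
    ext k
    simp only [Pi.smul_apply, map_smul, RingHom.id_apply, Finset.smul_sum]
    exact Finset.sum_congr rfl fun m _ => smul_comm _ _ _

/-- The general Leibniz rule, with the binomial coefficient absorbed in divided powers. -/
theorem divided_pow_leibniz (B : R →ₗ[ℝ] R →ₗ[ℝ] R) (D : Module.End ℝ R)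
    (hD : ∀ f g, D (B f g) = B (D f) g + B f (D g)) (m : ℕ) (f g : R) :
    (m.factorial : ℝ)⁻¹ • (D ^ m) (B f g) =
      ∑ p ∈ Finset.HasAntidiagonal.antidiagonal m,
        B ((p.1.factorial : ℝ)⁻¹ • (D ^ p.1) f) ((p.2.factorial : ℝ)⁻¹ • (D ^ p.2) g) := by
  have key : (D ^ m) (B f g) = ∑ p ∈ Finset.HasAntidiagonal.antidiagonal m,
      m.choose p.1 • B ((D ^ p.1) f) ((D ^ p.2) g) := by
    induction m with
    | zero => simp
    | succ m ih =>
      rw [Finset.sum_antidiagonal_choose_succ_nsmul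
        (M := R) (fun a b => B ((D ^ a) f) ((D ^ b) g)) m, pow_succ', Module.End.mul_apply, ih]
      simp only [map_sum, map_nsmul, hD, nsmul_add, Finset.sum_add_distrib, pow_succ',
        Module.End.mul_apply]
      rw [add_comm]
      congr 1
      refine Finset.sum_congr rfl fun p hp => ?_
      rw [Finset.HasAntidiagonal.mem_antidiagonal] at hp
      rw [Nat.choose_symm_of_eq_add hp.symm]
  rw [key, Finset.smul_sum]
  refine Finset.sum_congr rfl fun p hp => ?_
  rw [Finset.HasAntidiagonal.mem_antidiagonal] at hp
  subst hp
  simp only [map_smul, LinearMap.smul_apply, smul_smul, ← Nat.cast_smul_eq_nsmul ℝ]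
  congr 1
  have h' : ((p.1 + p.2).choose p.1 : ℝ) * p.1.factorial * p.2.factorial =
      (p.1 + p.2).factorial := by
    rw [Nat.choose_symm_add]
    exact_mod_cast Nat.add_choose_mul_factorial_mul_factorial p.1 p.2
  rw [← h']
  have h1 : (p.1.factorial : ℝ) ≠ 0 := by positivity
  have h2 : (p.2.factorial : ℝ) ≠ 0 := by positivity
  have h3 : ((p.1 + p.2).choose p.1 : ℝ) ≠ 0 := by
    exact_mod_cast (Nat.choose_pos (Nat.le_add_right _ _)).ne'
  field_simp

/-- The exponential of a derivation of `B` is an automorphism of `B`. -/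
theorem expSeries_conv (B : R →ₗ[ℝ] R →ₗ[ℝ] R) (D : Module.End ℝ R)
    (hD : ∀ f g, D (B f g) = B (D f) g + B f (D g)) {i : ℕ} (hi : 1 ≤ i) (F G : ℕ → R) :
    expSeries i D (conv B F G) = conv B (expSeries i D F) (expSeries i D G) := by
  ext k
  simp only [conv, expSeries, LinearMap.coe_mk, AddHom.coe_mk, map_sum, Finset.smul_sum,
    divided_pow_leibniz B D hD, LinearMap.sum_apply]
  simp only [Finset.sum_sigma']
  refine Finset.sum_bij'
    (fun x _ => ⟨(x.2.1.1 + i * x.2.2.1, x.2.1.2 + i * x.2.2.2), ⟨x.2.2.2, x.2.2.1⟩⟩)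
    (fun x _ => ⟨x.2.2 + x.2.1, ⟨(x.1.1 - i * x.2.2, x.1.2 - i * x.2.1), (x.2.2, x.2.1)⟩⟩)
    ?_ ?_ ?_ ?_ ?_
  · rintro ⟨m, ⟨a, b⟩, ⟨j, l⟩⟩ h
    simp only [Finset.mem_sigma, Finset.mem_filter, Finset.mem_range,
      Finset.HasAntidiagonal.mem_antidiagonal] at h ⊢
    obtain ⟨⟨h1, h2⟩, h3, rfl⟩ := h
    have hj : j ≤ i * j := Nat.le_mul_of_pos_left j hi
    have hl : l ≤ i * l := Nat.le_mul_of_pos_left l hi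
    rw [mul_add] at h2 h3
    omega
  · rintro ⟨⟨a, b⟩, ⟨l, j⟩⟩ h
    simp only [Finset.mem_sigma, Finset.mem_filter, Finset.mem_range,
      Finset.HasAntidiagonal.mem_antidiagonal] at h ⊢
    have hj : j ≤ i * j := Nat.le_mul_of_pos_left j hi
    have hl : l ≤ i * l := Nat.le_mul_of_pos_left l hi
    rw [mul_add]
    exact ⟨⟨by omega, by omega⟩, by omega, trivial⟩
  · rintro ⟨m, ⟨a, b⟩, ⟨j, l⟩⟩ h
    simp only [Finset.mem_sigma, Finset.mem_filter, Finset.mem_range,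
      Finset.HasAntidiagonal.mem_antidiagonal] at h ⊢
    obtain ⟨-, -, rfl⟩ := h
    simp
  · rintro ⟨⟨a, b⟩, ⟨l, j⟩⟩ h
    simp only [Finset.mem_sigma, Finset.mem_filter, Finset.mem_range,
      Finset.HasAntidiagonal.mem_antidiagonal] at h ⊢
    rw [Nat.sub_add_cancel h.2.2.2, Nat.sub_add_cancel h.2.1.2]
  · rintro ⟨m, ⟨a, b⟩, ⟨j, l⟩⟩ h
    simp

theorem expSeries_apply_of_lt {i : ℕ} (D : Module.End ℝ R) (F : ℕ → R) {k : ℕ} (hk : k < i) :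
    expSeries i D F k = F k := by
  have : (Finset.range (k + 1)).filter (fun m => i * m ≤ k) = {0} := by
    ext m
    rcases m with _ | m
    · simp
    · have : k < i * (m + 1) := by nlinarith
      simp; omega
  simp [expSeries, this]

theorem expSeries_apply_self {i : ℕ} (hi : 1 ≤ i) (D : Module.End ℝ R) (F : ℕ → R) :
    expSeries i D F i = F i + D (F 0) := by
  have : (Finset.range (i + 1)).filter (fun m => i * m ≤ i) = {0, 1} := by
    ext m
    rcases m with _ | _ | m
    · simp
    · simp; omega
    · have : i < i * (m + 1 + 1) := by nlinarith
      simp; omega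
  simp [expSeries, this]

/-- An operator on series is unitriangular if it fixes the leading coefficient of every series. -/
def Unitriangular (Φ : (ℕ → R) →ₗ[ℝ] (ℕ → R)) : Prop :=
  ∀ (F : ℕ → R) (n : ℕ), (∀ k < n, F k = 0) → (∀ k < n, Φ F k = 0) ∧ Φ F n = F n

theorem unitriangular_expSeries {i : ℕ} (hi : 1 ≤ i) (D : Module.End ℝ R) :
    Unitriangular (expSeries i D) := by
  intro F n hF
  have key : ∀ k ≤ n, expSeries i D F k = F k := by
    intro k hk
    simp only [expSeries, LinearMap.coe_mk, AddHom.coe_mk]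
    rw [Finset.sum_eq_single_of_mem 0 (by simp)]
    · simp
    · intro m hm hm0
      rw [Finset.mem_filter] at hm
      have : 0 < i * m := Nat.mul_pos hi (Nat.pos_of_ne_zero hm0)
      rw [hF _ (by omega)]
      simp
  exact ⟨fun k hk => by rw [key k hk.le, hF k hk], key n le_rfl⟩

theorem Unitriangular.comp {Φ Ψ : (ℕ → R) →ₗ[ℝ] (ℕ → R)} (hΦ : Unitriangular Φ)
    (hΨ : Unitriangular Ψ) : Unitriangular (Φ ∘ₗ Ψ) := by
  intro F n hF
  obtain ⟨h1, h2⟩ := hΨ F n hF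
  obtain ⟨h3, h4⟩ := hΦ _ n h1
  exact ⟨h3, h4.trans h2⟩

/-- A unitriangular operator is injective modulo every power of `ε`. -/
theorem Unitriangular.eq_zero {Φ : (ℕ → R) →ₗ[ℝ] (ℕ → R)} (hΦ : Unitriangular Φ) {F : ℕ → R}
    {n : ℕ} (h : ∀ k < n, Φ F k = 0) : ∀ k < n, F k = 0 := by
  intro k
  induction k using Nat.strong_induction_on with
  | _ k ih =>
    intro hk
    rw [← (hΦ F k fun j hj => ih j hj (hj.trans hk)).2]
    exact h k hk

/-- A unitriangular operator is surjective modulo every power of `ε`. -/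
theorem Unitriangular.exists_preimage {Φ : (ℕ → R) →ₗ[ℝ] (ℕ → R)} (hΦ : Unitriangular Φ)
    (A : ℕ → R) (n : ℕ) : ∃ B : ℕ → R, ∀ k < n, Φ B k = A k := by
  induction n with
  | zero => exact ⟨0, by simp⟩
  | succ n ih =>
    obtain ⟨B, hB⟩ := ih
    obtain ⟨h1, h2⟩ := hΦ (Pi.single n (A n - Φ B n)) n
      fun k hk => Pi.single_eq_of_ne hk.ne _
    refine ⟨B + Pi.single n (A n - Φ B n), fun k hk => ?_⟩
    rw [map_add, Pi.add_apply]
    rcases Nat.lt_succ_iff_lt_or_eq.mp hk with hk | rfl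
    · rw [h1 k hk, add_zero, hB k hk]
    · rw [h2, Pi.single_eq_same]
      abel

/-- An operator on series is linear over `ℝ⟦ε⟧`: it is determined by its values on constant
series. -/
def EpsLinear (Φ : (ℕ → R) →ₗ[ℝ] (ℕ → R)) : Prop :=
  ∀ (F : ℕ → R) (k : ℕ),
    Φ F k = ∑ p ∈ Finset.HasAntidiagonal.antidiagonal k, Φ (Pi.single 0 (F p.1)) p.2

theorem epsLinear_expSeries {i : ℕ} (hi : 1 ≤ i) (D : Module.End ℝ R) :
    EpsLinear (expSeries i D) := by
  intro F k
  simp only [expSeries, LinearMap.coe_mk, AddHom.coe_mk, Finset.sum_sigma']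
  refine Finset.sum_of_injOn (fun m => ⟨(k - i * m, i * m), m⟩) ?_ ?_ ?_ ?_
  · intro m _ n _ h
    exact congrArg Sigma.snd h
  · intro m hm
    have := Nat.le_mul_of_pos_left m hi
    simp at hm ⊢
    omega
  · rintro ⟨⟨a, b⟩, m⟩ h h'
    simp only [Finset.mem_sigma, Finset.mem_filter, Finset.mem_range,
      Finset.HasAntidiagonal.mem_antidiagonal] at h
    rw [Pi.single_eq_of_ne, map_zero, smul_zero]
    intro h0
    obtain rfl : b = i * m := by simp only at h0; omega
    refine h' ⟨m, ?_, ?_⟩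
    · have := Nat.le_mul_of_pos_left m hi
      simp only [Finset.coe_filter, Finset.mem_range, Set.mem_ofPred_eq]
      omega
    · simp only [Sigma.mk.injEq, Prod.mk.injEq, heq_eq_eq, and_true]
      omega
  · intro m _
    simp

theorem EpsLinear.comp {Φ Ψ : (ℕ → R) →ₗ[ℝ] (ℕ → R)} (hΦ : EpsLinear Φ)
    (hΨ : EpsLinear Ψ) : EpsLinear (Φ ∘ₗ Ψ) := by
  intro F k
  simp only [LinearMap.comp_apply]
  rw [hΦ, Finset.sum_congr (s₂ := Finset.HasAntidiagonal.antidiagonal k) rfl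
    fun p _ => hΦ (Ψ (Pi.single 0 (F p.1))) p.2]
  rw [← sum_antidiagonal_assoc k fun a b c => Φ (Pi.single 0 (Ψ (Pi.single 0 (F a)) b)) c]
  refine Finset.sum_congr rfl fun p _ => ?_
  rw [hΨ F p.1, ← LinearMap.single_apply ℝ (fun _ : ℕ => R), map_sum, map_sum, Finset.sum_apply]
  rfl

end Series

/-! ### The Poisson algebra of smooth observables -/

theorem isOpen_phaseSpace : IsOpen phaseSpace :=
  isOpen_ne.preimage continuous_fst

/-- The smooth functions on the phase space, as a subalgebra of all functions. -/
def obsSubalgebra : Subalgebra ℝ (phaseSpace → ℝ) where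
  carrier := {f | ∃ F, SmoothObs F ∧ ∀ x : phaseSpace, F x = f x}
  mul_mem' := by
    rintro f g ⟨F, hF, hf⟩ ⟨G, hG, hg⟩
    exact ⟨F * G, hF.mul hG, fun x => by simp [hf, hg]⟩
  add_mem' := by
    rintro f g ⟨F, hF, hf⟩ ⟨G, hG, hg⟩
    exact ⟨F + G, hF.add hG, fun x => by simp [hf, hg]⟩
  algebraMap_mem' r := ⟨fun _ => r, contDiffOn_const, fun _ => rfl⟩

/-- The algebra of smooth functions on the phase space, as a type of its own: instance search on it
does not have to go through the subalgebra. -/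
def Obs : Type := obsSubalgebra

instance : CommRing Obs := inferInstanceAs (CommRing obsSubalgebra)

instance : Algebra ℝ Obs := inferInstanceAs (Algebra ℝ obsSubalgebra)

/-- The function `F` on pairs represents the smooth observable `f`. -/
def Rep (F : Pt → ℝ) (f : Obs) : Prop :=
  SmoothObs F ∧ ∀ x : phaseSpace, F x = f.1 x

theorem exists_rep (f : Obs) : ∃ F, Rep F f := f.2

theorem SmoothObs.exists_obs {F : Pt → ℝ} (hF : SmoothObs F) : ∃ f : Obs, Rep F f :=
  ⟨⟨fun x => F x, F, hF, fun _ => rfl⟩, hF, fun _ => rfl⟩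

namespace Rep

variable {F G : Pt → ℝ} {f g : Obs}

theorem eqOn (hF : Rep F f) (hG : Rep G f) : Set.EqOn F G phaseSpace :=
  fun x hx => (hF.2 ⟨x, hx⟩).trans (hG.2 ⟨x, hx⟩).symm

theorem eq_of_eqOn (hF : Rep F f) (hG : Rep G g) (h : Set.EqOn F G phaseSpace) : f = g :=
  Subtype.ext <| funext fun x => by rw [← hF.2, ← hG.2, h x.2]

theorem congr (hF : Rep F f) (h : Set.EqOn G F phaseSpace) : Rep G f :=
  ⟨ContDiffOn.congr hF.1 h, fun x => (h x.2).trans (hF.2 x)⟩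

theorem add (hF : Rep F f) (hG : Rep G g) : Rep (F + G) (f + g) :=
  ⟨ContDiffOn.add hF.1 hG.1, fun x => congrArg₂ (· + ·) (hF.2 x) (hG.2 x)⟩

theorem sub (hF : Rep F f) (hG : Rep G g) : Rep (F - G) (f - g) :=
  ⟨ContDiffOn.sub hF.1 hG.1, fun x => congrArg₂ (· - ·) (hF.2 x) (hG.2 x)⟩

theorem mul (hF : Rep F f) (hG : Rep G g) : Rep (F * G) (f * g) :=
  ⟨ContDiffOn.mul hF.1 hG.1, fun x => congrArg₂ (· * ·) (hF.2 x) (hG.2 x)⟩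

theorem smul (c : ℝ) (hF : Rep F f) : Rep (c • F) (c • f) :=
  ⟨ContDiffOn.const_smul c hF.1, fun x => congrArg (c * ·) (hF.2 x)⟩

theorem one : Rep 1 1 := ⟨contDiffOn_const, fun _ => rfl⟩

theorem zero : Rep 0 0 := ⟨contDiffOn_const, fun _ => rfl⟩

theorem pow (hF : Rep F f) (n : ℕ) : Rep (F ^ n) (f ^ n) :=
  ⟨ContDiffOn.pow hF.1 n, fun x => congrArg (· ^ n) (hF.2 x)⟩

theorem sum {ι : Type*} {s : Finset ι} {F : ι → Pt → ℝ} {f : ι → Obs}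
    (h : ∀ i ∈ s, Rep (F i) (f i)) : Rep (∑ i ∈ s, F i) (∑ i ∈ s, f i) := by
  classical
  induction s using Finset.induction_on with
  | empty => simpa using zero
  | insert a s ha ih =>
    rw [Finset.sum_insert ha, Finset.sum_insert ha]
    exact (h a (Finset.mem_insert_self a s)).add
      (ih fun i hi => h i (Finset.mem_insert_of_mem hi))

theorem contDiffAt (hF : Rep F f) {x : Pt} (hx : x ∈ phaseSpace) : ContDiffAt ℝ ∞ F x :=
  ContDiffOn.contDiffAt hF.1 (isOpen_phaseSpace.mem_nhds hx)

theorem differentiableAt (hF : Rep F f) {x : Pt} (hx : x ∈ phaseSpace) :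
    DifferentiableAt ℝ F x :=
  (hF.contDiffAt hx).differentiableAt (by simp)

end Rep

theorem SmoothObs.fderiv_apply {F : Pt → ℝ} (hF : SmoothObs F) (v : Pt) :
    SmoothObs fun x => fderiv ℝ F x v :=
  (ContDiffOn.fderiv_of_isOpen hF isOpen_phaseSpace (m := ∞) (by simp)).clm_apply
    contDiffOn_const

theorem eqOn_fderiv {F G : Pt → ℝ} (h : Set.EqOn F G phaseSpace) {x : Pt}
    (hx : x ∈ phaseSpace) : fderiv ℝ F x = fderiv ℝ G x :=
  (h.eventuallyEq_of_mem (isOpen_phaseSpace.mem_nhds hx)).fderiv_eq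

/-- The directional derivative of a smooth observable. -/
def dirFun (v : Pt) (f : Obs) : Obs :=
  ((exists_rep f).choose_spec.1.fderiv_apply v).exists_obs.choose

theorem rep_dirFun {F : Pt → ℝ} {f : Obs} (hF : Rep F f) (v : Pt) :
    Rep (fun x => fderiv ℝ F x v) (dirFun v f) := by
  have h := ((exists_rep f).choose_spec.1.fderiv_apply v).exists_obs.choose_spec
  refine h.congr fun x hx => ?_
  simp only
  rw [eqOn_fderiv (hF.eqOn (exists_rep f).choose_spec) hx]

/-- The derivation of the algebra of smooth observables in the direction `v`. -/
def dir (v : Pt) : Derivation ℝ Obs Obs :=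
  Derivation.mk'
    { toFun := dirFun v
      map_add' := fun f g => by
        obtain ⟨F, hF⟩ := exists_rep f
        obtain ⟨G, hG⟩ := exists_rep g
        refine (rep_dirFun (hF.add hG) v).eq_of_eqOn
          ((rep_dirFun hF v).add (rep_dirFun hG v)) fun x hx => ?_
        simp [fderiv_add (hF.differentiableAt hx) (hG.differentiableAt hx)]
      map_smul' := fun c f => by
        obtain ⟨F, hF⟩ := exists_rep f
        refine (rep_dirFun (hF.smul c) v).eq_of_eqOn
          ((rep_dirFun hF v).smul c) fun x hx => ?_
        simp [fderiv_const_smul (hF.differentiableAt hx)] }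
    fun f g => by
      obtain ⟨F, hF⟩ := exists_rep f
      obtain ⟨G, hG⟩ := exists_rep g
      refine (rep_dirFun (hF.mul hG) v).eq_of_eqOn
        ((hF.mul (rep_dirFun hG v)).add (hG.mul (rep_dirFun hF v))) fun x hx => ?_
      simp [fderiv_mul (hF.differentiableAt hx) (hG.differentiableAt hx)]

theorem Rep.dir {F : Pt → ℝ} {f : Obs} (hF : Rep F f) (v : Pt) :
    Rep (fun x => fderiv ℝ F x v) (dir v f) := rep_dirFun hF v

/-- Mixed second derivatives agree. -/
theorem dir_comm (v w : Pt) (f : Obs) : dir v (dir w f) = dir w (dir v f) := by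
  obtain ⟨F, hF⟩ := exists_rep f
  refine ((hF.dir w).dir v).eq_of_eqOn ((hF.dir v).dir w) fun x hx => ?_
  have hs : IsSymmSndFDerivAt ℝ F x := (hF.contDiffAt hx).isSymmSndFDerivAt (by
    simpa using WithTop.coe_le_coe.mpr (le_top : (2 : ℕ∞) ≤ ⊤))
  have hd : DifferentiableAt ℝ (fderiv ℝ F) x :=
    ((hF.contDiffAt hx).fderiv_right (m := ∞) (by simp)).differentiableAt (by simp)
  have key : ∀ a b : Pt, fderiv ℝ (fun y => fderiv ℝ F y a) x b = fderiv ℝ (fderiv ℝ F) x b a := by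
    intro a b
    rw [fderiv_clm_apply hd (differentiableAt_const a)]
    simp
  simp only [key]
  exact hs v w

/-- The partial derivative with respect to `qᵢ`. -/
def dq (i : Fin 3) : Derivation ℝ Obs Obs := dir (EuclideanSpace.single i 1, 0)

/-- The partial derivative with respect to `pᵢ`. -/
def dp (i : Fin 3) : Derivation ℝ Obs Obs := dir (0, EuclideanSpace.single i 1)

/-- The Poisson bracket on the algebra of smooth observables. -/
def br : Obs →ₗ[ℝ] Obs →ₗ[ℝ] Obs :=
  LinearMap.mk₂ ℝ (fun f g => ∑ i : Fin 3, (dq i f * dp i g - dp i f * dq i g))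
    (fun f f' g => by
      rw [← Finset.sum_add_distrib]
      exact Finset.sum_congr rfl fun i _ => by simp only [map_add]; ring)
    (fun c f g => by
      rw [Finset.smul_sum]
      exact Finset.sum_congr rfl fun i _ => by simp [smul_sub])
    (fun f g g' => by
      rw [← Finset.sum_add_distrib]
      exact Finset.sum_congr rfl fun i _ => by simp only [map_add]; ring)
    (fun c f g => by
      rw [Finset.smul_sum]
      exact Finset.sum_congr rfl fun i _ => by simp [smul_sub])

theorem br_apply (f g : Obs) : br f g = ∑ i : Fin 3, (dq i f * dp i g - dp i f * dq i g) :=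
  rfl

theorem Rep.pb {F G : Pt → ℝ} {f g : Obs} (hF : Rep F f) (hG : Rep G g) :
    Rep (pb F G) (br f g) := by
  rw [br_apply]
  refine (Rep.sum (s := Finset.univ) fun i _ => ((hF.dir _).mul (hG.dir _)).sub
    ((hF.dir _).mul (hG.dir _))).congr fun x _ => ?_
  simp [PNKepler.pb]

theorem br_antisymm (f g : Obs) : br f g = -br g f := by
  simp only [br_apply, ← Finset.sum_neg_distrib]
  exact Finset.sum_congr rfl fun i _ => by ring

theorem br_self (f : Obs) : br f f = 0 := by
  rw [br_apply]
  exact Finset.sum_eq_zero fun i _ => by ring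

theorem br_mul (f g h : Obs) : br f (g * h) = br f g * h + g * br f h := by
  simp only [br_apply, Derivation.leibniz, smul_eq_mul, Finset.sum_mul, Finset.mul_sum,
    ← Finset.sum_add_distrib]
  exact Finset.sum_congr rfl fun i _ => by ring

theorem mul_br (f g h : Obs) : br (f * g) h = br f h * g + f * br g h := by
  rw [br_antisymm, br_mul, br_antisymm h f, br_antisymm h g]
  ring

theorem br_one (f : Obs) : br f 1 = 0 := by simp [br_apply]

/-- The Jacobi identity. -/
theorem br_jacobi (f g h : Obs) : br f (br g h) = br (br f g) h + br g (br f h) := by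
  have hqq : ∀ i j k, dq i (dq j k) = dq j (dq i k) := fun i j k => dir_comm _ _ k
  have hpp : ∀ i j k, dp i (dp j k) = dp j (dp i k) := fun i j k => dir_comm _ _ k
  have hpq : ∀ i j k, dp i (dq j k) = dq j (dp i k) := fun i j k => dir_comm _ _ k
  simp only [br_apply, Fin.sum_univ_three]
  simp only [map_add, map_sub, Derivation.leibniz, smul_eq_mul, hpq,
    hqq 1 0, hqq 2 0, hqq 2 1, hpp 1 0, hpp 2 0, hpp 2 1]
  ring

theorem br_pow (f g : Obs) (n : ℕ) : br f (g ^ (n + 1)) = (n + 1 : ℝ) • (g ^ n * br f g) := by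
  induction n with
  | zero => simp
  | succ n ih =>
    rw [pow_succ, br_mul, ih]
    push_cast
    simp only [Algebra.smul_def, map_add, map_one]
    ring

/-! ### Rotationally invariant observables and their brackets -/

/-- The coordinate `qᵢ`. -/
def Q (i : Fin 3) : Obs :=
  ⟨fun x => x.1.1 i, fun x => x.1 i, by unfold SmoothObs; fun_prop, fun _ => rfl⟩

/-- The coordinate `pᵢ`. -/
def P (i : Fin 3) : Obs :=
  ⟨fun x => x.1.2 i, fun x => x.2 i, by unfold SmoothObs; fun_prop, fun _ => rfl⟩

theorem smoothObs_inv_radius : SmoothObs fun x => (radius x)⁻¹ := by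
  intro x hx
  have h : x.1 ≠ 0 := hx
  exact ((contDiffAt_fst.norm ℝ h).inv (norm_ne_zero_iff.mpr h)).contDiffWithinAt

/-- The inverse radius `1 / r`. -/
def s : Obs := ⟨fun x => (radius x.1)⁻¹, fun x => (radius x)⁻¹, smoothObs_inv_radius, fun _ => rfl⟩

/-- The generator `p · q` of scalings. -/
def d : Obs := P 0 * Q 0 + P 1 * Q 1 + P 2 * Q 2

/-- The square `p²`. -/
def u : Obs := P 0 * P 0 + P 1 * P 1 + P 2 * P 2

/-- The square `p_r²` of the radial momentum. -/
def v : Obs := d * d * (s * s)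

/-- The Kepler Hamiltonian. -/
def E : Obs := (1 / 2 : ℝ) • u - s

/-- The quantity `p² - p_r² = L² / r²`. -/
def y : Obs := u - v

/-- The Laplace-Runge-Lenz vector. -/
def lrlObs (i : Fin 3) : Obs := (u - s) * Q i - d * P i

theorem rep_Q (i : Fin 3) : Rep (fun x => x.1 i) (Q i) :=
  ⟨by unfold SmoothObs; fun_prop, fun _ => rfl⟩

theorem rep_P (i : Fin 3) : Rep (fun x => x.2 i) (P i) :=
  ⟨by unfold SmoothObs; fun_prop, fun _ => rfl⟩

theorem rep_s : Rep (fun x => (radius x)⁻¹) s := ⟨smoothObs_inv_radius, fun _ => rfl⟩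

theorem rep_d : Rep dotPQ d :=
  ((((rep_P 0).mul (rep_Q 0)).add ((rep_P 1).mul (rep_Q 1))).add
    ((rep_P 2).mul (rep_Q 2))).congr fun x _ => by
      simp [dotPQ, PiLp.inner_apply, Fin.sum_univ_three]; ring

theorem rep_u : Rep (fun x => ‖x.2‖ ^ 2) u :=
  ((((rep_P 0).mul (rep_P 0)).add ((rep_P 1).mul (rep_P 1))).add
    ((rep_P 2).mul (rep_P 2))).congr fun x _ => by
      simp [EuclideanSpace.norm_sq_eq, Fin.sum_univ_three]; ring

theorem rep_v : Rep (fun x => radialMom x ^ 2) v :=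
  ((rep_d.mul rep_d).mul (rep_s.mul rep_s)).congr fun x _ => by
    simp only [radialMom, Pi.mul_apply]; ring

theorem rep_E : Rep kepler E :=
  ((rep_u.smul (1 / 2)).sub rep_s).congr fun x _ => by
    simp only [kepler, Pi.sub_apply, Pi.smul_apply, smul_eq_mul]; ring

theorem s_mul_s_mul_Q : s * s * (Q 0 * Q 0 + Q 1 * Q 1 + Q 2 * Q 2) = 1 := by
  refine ((rep_s.mul rep_s).mul ((((rep_Q 0).mul (rep_Q 0)).add ((rep_Q 1).mul (rep_Q 1))).add
    ((rep_Q 2).mul (rep_Q 2)))).eq_of_eqOn Rep.one fun x hx => ?_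
  have h : radius x ≠ 0 := norm_ne_zero_iff.mpr hx
  have h2 : radius x ^ 2 = x.1 0 ^ 2 + x.1 1 ^ 2 + x.1 2 ^ 2 := by
    simp [radius, EuclideanSpace.norm_sq_eq, Fin.sum_univ_three]
  simp only [Pi.mul_apply, Pi.add_apply, Pi.one_apply]
  field_simp
  rw [h2]

theorem rep_lrl (i : Fin 3) : Rep (lrl i) (lrlObs i) := by
  refine (((rep_u.sub rep_s).mul (rep_Q i)).sub (rep_d.mul (rep_P i))).congr fun x _ => ?_
  simp only [lrl, Pi.mul_apply, Pi.sub_apply]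
  fin_cases i <;>
  simp [crossProduct, dotPQ, PiLp.inner_apply, Fin.sum_univ_three,
    EuclideanSpace.norm_sq_eq] <;> ring

theorem dir_Q (w : Pt) (i : Fin 3) : dir w (Q i) = w.1 i • (1 : Obs) := by
  refine ((rep_Q i).dir w).eq_of_eqOn (Rep.one.smul _) fun x _ => ?_
  have : HasFDerivAt (fun x : Pt => x.1 i)
      ((EuclideanSpace.proj i : Vec →L[ℝ] ℝ) ∘L ContinuousLinearMap.fst ℝ Vec Vec) x :=
    ((EuclideanSpace.proj i : Vec →L[ℝ] ℝ) ∘L ContinuousLinearMap.fst ℝ Vec Vec).hasFDerivAt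
  simp [this.fderiv]

theorem dir_P (w : Pt) (i : Fin 3) : dir w (P i) = w.2 i • (1 : Obs) := by
  refine ((rep_P i).dir w).eq_of_eqOn (Rep.one.smul _) fun x _ => ?_
  have : HasFDerivAt (fun x : Pt => x.2 i)
      ((EuclideanSpace.proj i : Vec →L[ℝ] ℝ) ∘L ContinuousLinearMap.snd ℝ Vec Vec) x :=
    ((EuclideanSpace.proj i : Vec →L[ℝ] ℝ) ∘L ContinuousLinearMap.snd ℝ Vec Vec).hasFDerivAt
  simp [this.fderiv]

theorem dq_Q (i j : Fin 3) : dq i (Q j) = if j = i then 1 else 0 := by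
  rw [dq, dir_Q]; split_ifs with h <;> simp [h]

theorem dp_P (i j : Fin 3) : dp i (P j) = if j = i then 1 else 0 := by
  rw [dp, dir_P]; split_ifs with h <;> simp [h]

theorem dq_P (i j : Fin 3) : dq i (P j) = 0 := by simp [dq, dir_P]

theorem dp_Q (i j : Fin 3) : dp i (Q j) = 0 := by simp [dp, dir_Q]

/-- The derivatives of `1 / r` follow from the relation `q² / r² = 1`. -/
theorem two_mul_derivation_s (D : Derivation ℝ Obs Obs) :
    2 * D s = -(s * s * s) * (2 * (Q 0 * D (Q 0) + Q 1 * D (Q 1) + Q 2 * D (Q 2))) := by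
  have h := congrArg D s_mul_s_mul_Q
  simp only [Derivation.leibniz, map_add, smul_eq_mul, Derivation.map_one_eq_zero] at h
  linear_combination s * h - 2 * D s * s_mul_s_mul_Q

theorem two_mul_cancel {f g : Obs} (h : 2 * f = 2 * g) : f = g := by
  have h2 : (2 : ℝ) • f = (2 : ℝ) • g := by
    simpa [Algebra.smul_def, map_ofNat] using h
  exact smul_right_injective _ two_ne_zero h2

theorem dq_s (i : Fin 3) : dq i s = -(s * s * s) * Q i := by
  apply two_mul_cancel
  rw [two_mul_derivation_s]
  fin_cases i <;> simp [dq_Q] <;> ring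

theorem dp_s (i : Fin 3) : dp i s = 0 := by
  apply two_mul_cancel
  rw [two_mul_derivation_s]
  simp [dp_Q]

theorem br_Q_Q (i j : Fin 3) : br (Q i) (Q j) = 0 := by simp [br_apply, dp_Q]

theorem br_P_P (i j : Fin 3) : br (P i) (P j) = 0 := by simp [br_apply, dq_P]

theorem br_Q_P (i j : Fin 3) : br (Q i) (P j) = if i = j then 1 else 0 := by
  simp [br_apply, dq_Q, dp_P, dq_P]

theorem br_P_Q (i j : Fin 3) : br (P i) (Q j) = if i = j then -1 else 0 := by
  rw [br_antisymm, br_Q_P]; split_ifs <;> simp_all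

theorem br_s_Q (i : Fin 3) : br s (Q i) = 0 := by simp [br_apply, dp_s, dp_Q]

theorem br_s_P (i : Fin 3) : br s (P i) = -(s * s * s) * Q i := by
  simp [br_apply, dp_s, dq_s, dp_P]

theorem br_P_s (i : Fin 3) : br (P i) s = s * s * s * Q i := by
  rw [br_antisymm, br_s_P]; ring

theorem br_d_Q (i : Fin 3) : br d (Q i) = -Q i := by
  simp only [d, map_add, LinearMap.add_apply, mul_br, br_P_Q, br_Q_Q]
  fin_cases i <;> simp

theorem br_d_P (i : Fin 3) : br d (P i) = P i := by
  simp only [d, map_add, LinearMap.add_apply, mul_br, br_Q_P, br_P_P]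
  fin_cases i <;> simp

theorem br_d_s : br d s = s := by
  simp only [d, map_add, LinearMap.add_apply, mul_br, br_P_s, br_antisymm (Q _) s, br_s_Q]
  linear_combination s * s_mul_s_mul_Q

theorem br_d_u : br d u = 2 * u := by
  simp only [u, map_add, br_mul, br_d_P]
  ring

theorem br_d_v : br d v = 2 * v := by
  simp only [v, br_mul, br_d_s, br_self]
  ring

theorem br_u_Q (i : Fin 3) : br u (Q i) = -2 * P i := by
  simp only [u, map_add, LinearMap.add_apply, mul_br, br_P_Q]
  fin_cases i <;> simp <;> ring

theorem br_u_P (i : Fin 3) : br u (P i) = 0 := by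
  simp [u, mul_br, br_P_P]

theorem br_u_s : br u s = 2 * (d * s * s) * s := by
  simp only [u, d, map_add, LinearMap.add_apply, mul_br, br_P_s]
  ring

theorem br_v_Q (i : Fin 3) : br v (Q i) = -2 * (d * s * s) * Q i := by
  simp only [v, mul_br, br_d_Q, br_s_Q]
  ring

theorem br_v_P (i : Fin 3) : br v (P i) = 2 * d * s * s * P i - 2 * v * s * s * Q i := by
  simp only [v, mul_br, br_d_P, br_s_P]
  ring

theorem br_u_v : br u v = d * s * s * (4 * (v - u)) := by
  rw [v]
  simp only [br_mul, br_antisymm u d, br_d_u, br_u_s]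
  ring

theorem br_s_v : br s v = d * s * s * (-2 * s) := by
  rw [v]
  simp only [br_mul, br_antisymm s d, br_d_s, br_self]
  ring

theorem u_eq : u = 2 * E + 2 * s := by
  have h : 2 * ((1 / 2 : ℝ) • u) = u := by
    rw [two_mul, ← add_smul]; norm_num
  rw [E, mul_sub, h]; ring

theorem v_eq : v = 2 * E + 2 * s - y := by
  rw [← u_eq, y]; ring

theorem two_mul_br_E (f : Obs) : 2 * br f E = br f u - 2 * br f s := by
  have h := congrArg (br f) u_eq
  simp only [two_mul, map_add] at h ⊢
  linear_combination -h

theorem br_d_E : br d E = 2 * E + s := by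
  apply two_mul_cancel
  rw [two_mul_br_E, br_d_u, br_d_s, u_eq]
  ring

theorem br_s_E : br s E = -(d * s * s * s) := by
  apply two_mul_cancel
  rw [two_mul_br_E, br_antisymm s u, br_u_s, br_self]
  ring

theorem br_y_s : br y s = 0 := by
  simp only [y, map_sub, LinearMap.sub_apply, br_u_s, br_antisymm v s, br_s_v]
  ring

theorem br_y_u : br y u = -4 * d * s * s * y := by
  simp only [y, map_sub, LinearMap.sub_apply, br_self, br_antisymm v u, br_u_v]
  ring

theorem br_y_E : br y E = -2 * d * s * s * y := by
  apply two_mul_cancel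
  rw [two_mul_br_E, br_y_u, br_y_s]
  ring

/-- The Laplace-Runge-Lenz vector is conserved by the Kepler Hamiltonian. -/
theorem br_E_lrlObs (i : Fin 3) : br E (lrlObs i) = 0 := by
  rw [br_antisymm, neg_eq_zero]
  apply two_mul_cancel
  rw [two_mul_br_E]
  simp only [lrlObs, map_sub, LinearMap.sub_apply, mul_br, br_antisymm (Q i) u, br_u_Q,
    br_antisymm (P i) u, br_u_P, br_antisymm (Q i) s, br_s_Q, br_antisymm (P i) s, br_s_P,
    br_d_u, br_d_s, br_u_s, br_antisymm s u, br_self]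
  ring

theorem br_y_lrlObs (i : Fin 3) :
    br y (lrlObs i) = 2 * s * P i - 2 * d * s * s * (y + s) * Q i := by
  have hv : v = d * d * (s * s) := rfl
  simp only [lrlObs, map_sub, br_mul, br_y_u, br_y_s]
  simp only [y, map_sub, LinearMap.sub_apply, br_u_Q, br_u_P, br_v_Q, br_v_P, br_antisymm u d,
    br_antisymm v d, br_d_u, br_d_v]
  linear_combination (-2 * P i) * hv

/-! ### The grading by post-Newtonian weight -/

/-- A power of the span of three elements is spanned by monomials. -/
theorem span_triple_pow_le {R : Type*} [CommRing R] [Algebra ℝ R] (a b c : R) (w : ℕ) :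
    Submodule.span ℝ {a, b, c} ^ w ≤
      Submodule.span ℝ {x | ∃ l m n, l + m + n = w ∧ x = a ^ l * b ^ m * c ^ n} := by
  induction w with
  | zero =>
    rw [pow_zero, Submodule.one_eq_span]
    exact Submodule.span_mono (by rintro _ rfl; exact ⟨0, 0, 0, rfl, by simp⟩)
  | succ w ih =>
    rw [pow_succ]
    refine (mul_le_mul' ih le_rfl).trans ?_
    rw [Submodule.span_mul_span]
    refine Submodule.span_mono ?_
    rintro _ ⟨_, ⟨l, m, n, rfl, rfl⟩, z, hz, rfl⟩
    rcases hz with rfl | rfl | rfl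
    · exact ⟨l + 1, m, n, by ring, by ring⟩
    · exact ⟨l, m + 1, n, by ring, by ring⟩
    · exact ⟨l, m, n + 1, by ring, by ring⟩

/-- The span of `p²`, `1 / r` and `p_r²`. Its power `W ^ w` is the space of homogeneous forms
of weight `w`. -/
def W : Submodule ℝ Obs := Submodule.span ℝ {u, s, v}

theorem u_mem_W : u ∈ W := Submodule.subset_span (by simp)

theorem s_mem_W : s ∈ W := Submodule.subset_span (by simp)

theorem v_mem_W : v ∈ W := Submodule.subset_span (by simp)

theorem E_mem_W : E ∈ W := W.sub_mem (W.smul_mem _ u_mem_W) s_mem_W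

theorem mul_mem_W {f g : Obs} {m n : ℕ} (hf : f ∈ W ^ m) (hg : g ∈ W ^ n) :
    f * g ∈ W ^ (m + n) := by
  rw [pow_add]
  exact Submodule.mul_mem_mul hf hg

theorem W_mul_mem {f g : Obs} {n : ℕ} (hf : f ∈ W) (hg : g ∈ W ^ n) :
    f * g ∈ W ^ (n + 1) := by
  rw [pow_succ']
  exact Submodule.mul_mem_mul hf hg

/-- A Hamiltonian vector field mapping `W` into `S * W` maps `W ^ n` into `S * W ^ n`. -/
theorem br_mem_of_forall {f : Obs} {S : Submodule ℝ Obs} (h : ∀ x ∈ W, br f x ∈ S * W) (n : ℕ)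
    {x : Obs} (hx : x ∈ W ^ n) : br f x ∈ S * W ^ n := by
  induction n generalizing x with
  | zero =>
    rw [pow_zero, Submodule.mem_one] at hx
    obtain ⟨c, rfl⟩ := hx
    rw [Algebra.algebraMap_eq_smul_one, map_smul, br_one, smul_zero]
    exact zero_mem _
  | succ n ih =>
    rw [pow_succ] at hx ⊢
    refine Submodule.mul_induction_on hx (fun a ha b hb => ?_) fun a b ha hb => ?_
    · rw [br_mul]
      refine add_mem ?_ ?_
      · rw [← mul_assoc]
        exact Submodule.mul_mem_mul (ih ha) hb
      · rw [mul_left_comm]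
        exact Submodule.mul_mem_mul ha (h b hb)
    · rw [map_add]
      exact add_mem ha hb

theorem br_mem_of_generators {f : Obs} {S : Submodule ℝ Obs} (hu : br f u ∈ S) (hs : br f s ∈ S)
    (hv : br f v ∈ S) : ∀ x ∈ W, br f x ∈ S := by
  intro x hx
  refine Submodule.span_induction ?_ ?_ ?_ ?_ hx
  · rintro z (rfl | rfl | rfl) <;> assumption
  · rw [map_zero]; exact zero_mem _
  · intro a b _ _ ha hb
    rw [map_add]; exact add_mem ha hb
  · intro c a _ ha
    rw [map_smul]; exact S.smul_mem c ha

theorem ofNat_mul_mem {S : Submodule ℝ Obs} {f : Obs} (hf : f ∈ S) (n : ℕ) :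
    (n : Obs) * f ∈ S := by
  rw [← nsmul_eq_mul]
  exact S.nsmul_mem hf n

theorem br_d_mem {n : ℕ} {x : Obs} (hx : x ∈ W ^ n) : br d x ∈ W ^ n := by
  have h := br_mem_of_forall (f := d) (S := 1) (by
    rw [one_mul]
    refine br_mem_of_generators ?_ ?_ ?_
    · rw [br_d_u]; exact ofNat_mul_mem u_mem_W 2
    · rw [br_d_s]; exact s_mem_W
    · rw [br_d_v]; exact ofNat_mul_mem v_mem_W 2) n hx
  rwa [one_mul] at h

/-- The brackets of `p²`, `1 / r`, `p_r²` with forms of weight `n` are forms of weight `n`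
times `(p · q) / r²`. -/
theorem exists_br_eq {X : Obs} (hX : X ∈ W) {n : ℕ} {g : Obs} (hg : g ∈ W ^ n) :
    ∃ g' ∈ W ^ n, br g X = d * s * s * g' := by
  have key : ∀ x ∈ W, ∀ z ∈ W, br x z ∈ Submodule.span ℝ {d * s * s} * W := by
    have hmem : ∀ w ∈ W, d * s * s * w ∈ Submodule.span ℝ {d * s * s} * W := fun w hw =>
      Submodule.mul_mem_mul (Submodule.mem_span_singleton_self _) hw
    have huv := hmem _ (ofNat_mul_mem (W.sub_mem v_mem_W u_mem_W) 4)
    have hus := hmem _ (ofNat_mul_mem s_mem_W 2)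
    have hsv := hmem _ (W.neg_mem (ofNat_mul_mem s_mem_W 2))
    rw [show d * s * s * ((4 : ℕ) * (v - u)) = br u v by rw [br_u_v]; push_cast; ring] at huv
    rw [show d * s * s * ((2 : ℕ) * s) = br u s by rw [br_u_s]; push_cast; ring] at hus
    rw [show d * s * s * -((2 : ℕ) * s) = br s v by rw [br_s_v]; push_cast; ring] at hsv
    intro x hx
    have hzero : ∀ f, br f f ∈ Submodule.span ℝ {d * s * s} * W := fun f => by
      rw [br_self]; exact zero_mem _
    refine br_mem_of_generators ?_ ?_ ?_ <;> rw [br_antisymm] <;> apply neg_mem <;>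
      refine br_mem_of_generators ?_ ?_ ?_ x hx
    · exact hzero u
    · exact hus
    · exact huv
    · rw [br_antisymm]; exact neg_mem hus
    · exact hzero s
    · exact hsv
    · rw [br_antisymm]; exact neg_mem huv
    · rw [br_antisymm]; exact neg_mem hsv
    · exact hzero v
  have h := neg_mem (br_mem_of_forall (key X hX) n hg)
  rw [← br_antisymm] at h
  obtain ⟨g', hg', h⟩ := Submodule.mem_span_singleton_mul.mp h
  exact ⟨g', hg', h.symm⟩

/-- The Hamiltonian vector field of a generator `(p · q) g` raises the weight by that of `g`. -/
theorem br_generator_mem {i n : ℕ} {g x : Obs} (hg : g ∈ W ^ i) (hx : x ∈ W ^ n) :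
    br (d * g) x ∈ W ^ (n + i) := by
  have key : ∀ x ∈ W, br (d * g) x ∈ W ^ i * W := by
    intro x hx
    obtain ⟨g', hg', h⟩ := exists_br_eq hx hg
    rw [mul_br, h, mul_comm (W ^ i)]
    refine add_mem (Submodule.mul_mem_mul ?_ hg) ?_
    · simpa using br_d_mem (n := 1) (by simpa using hx)
    · rw [show d * (d * s * s * g') = v * g' by rw [v]; ring]
      exact Submodule.mul_mem_mul v_mem_W hg'
  rw [pow_add, mul_comm]
  exact br_mem_of_forall key n hx

/-- The vector fields `a (p · q) p + b q` with `a` of weight `w` and `b` of weight `w + 1`. -/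
def V (w : ℕ) : Submodule ℝ (Fin 3 → Obs) where
  carrier := {A | ∃ a ∈ W ^ w, ∃ b ∈ W ^ (w + 1), ∀ k, A k = a * d * P k + b * Q k}
  zero_mem' := ⟨0, zero_mem _, 0, zero_mem _, fun k => by simp⟩
  add_mem' := by
    rintro A A' ⟨a, ha, b, hb, h⟩ ⟨a', ha', b', hb', h'⟩
    exact ⟨a + a', add_mem ha ha', b + b', add_mem hb hb',
      fun k => by rw [Pi.add_apply, h, h']; ring⟩
  smul_mem' := by
    rintro c A ⟨a, ha, b, hb, h⟩
    refine ⟨c • a, Submodule.smul_mem _ c ha, c • b, Submodule.smul_mem _ c hb, fun k => ?_⟩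
    rw [Pi.smul_apply, h, smul_add]
    simp only [smul_mul_assoc]

theorem smul_mem_V {m n : ℕ} {f : Obs} {A : Fin 3 → Obs} (hf : f ∈ W ^ m) (hA : A ∈ V n) :
    (fun k => f * A k) ∈ V (n + m) := by
  obtain ⟨a, ha, b, hb, h⟩ := hA
  refine ⟨f * a, ?_, f * b, ?_, fun k => by simp only [h]; ring⟩
  · rw [add_comm]; exact mul_mem_W hf ha
  · rw [show n + m + 1 = m + (n + 1) by ring]; exact mul_mem_W hf hb

theorem smul_d_P_mem_V {n : ℕ} {f : Obs} (hf : f ∈ W ^ n) : (fun k => f * (d * P k)) ∈ V n :=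
  ⟨f, hf, 0, zero_mem _, fun k => by ring⟩

theorem smul_Q_mem_V {n : ℕ} {f : Obs} (hf : f ∈ W ^ (n + 1)) : (fun k => f * Q k) ∈ V n :=
  ⟨0, zero_mem _, f, hf, fun k => by ring⟩

/-- A vector of derivations mapping the generators of `W` into `V 1` maps all forms of weight `i`
into `V i`. -/
theorem derivation_mem_V {D : Fin 3 → Obs → Obs} (hadd : ∀ k f g, D k (f + g) = D k f + D k g)
    (hsmul : ∀ k (c : ℝ) f, D k (c • f) = c • D k f)
    (hmul : ∀ k f g, D k (f * g) = g * D k f + f * D k g)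
    (hu : (fun k => D k u) ∈ V 1) (hs : (fun k => D k s) ∈ V 1) (hv : (fun k => D k v) ∈ V 1)
    {i : ℕ} {g : Obs} (hg : g ∈ W ^ i) : (fun k => D k g) ∈ V i := by
  have hadd' : ∀ {j} {f g : Obs}, (fun k => D k f) ∈ V j → (fun k => D k g) ∈ V j →
      (fun k => D k (f + g)) ∈ V j := by
    intro j f g hf hg
    simp only [hadd]
    exact (V j).add_mem hf hg
  have hzero : ∀ k, D k 0 = 0 := fun k => by simpa using hsmul k 0 0
  have hone : ∀ k, D k 1 = 0 := fun k => by simpa using hmul k 1 1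
  have hW : ∀ x ∈ W, (fun k => D k x) ∈ V 1 := by
    intro x hx
    refine Submodule.span_induction ?_ ?_ ?_ ?_ hx
    · rintro z (rfl | rfl | rfl) <;> assumption
    · simp only [hzero]; exact (V 1).zero_mem
    · intro a b _ _ ha hb
      exact hadd' ha hb
    · intro c a _ ha
      simp only [hsmul]; exact (V 1).smul_mem c ha
  induction i generalizing g with
  | zero =>
    rw [pow_zero, Submodule.mem_one] at hg
    obtain ⟨c, rfl⟩ := hg
    simp only [Algebra.algebraMap_eq_smul_one, hsmul, hone, smul_zero]
    exact (V 0).zero_mem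
  | succ i ih =>
    rw [pow_succ] at hg
    refine Submodule.mul_induction_on hg (fun a ha b hb => ?_) fun a b ha hb => hadd' ha hb
    simp only [hmul]
    refine (V (i + 1)).add_mem (smul_mem_V (m := 1) (by simpa using hb) (ih ha)) ?_
    rw [add_comm i]
    exact smul_mem_V ha (hW b hb)

theorem d_d_br_P_mem_V {i : ℕ} {g : Obs} (hg : g ∈ W ^ i) :
    (fun k => d * d * br g (P k)) ∈ V i := by
  have hv : v = d * d * (s * s) := rfl
  have hvs : v * s ∈ W ^ 2 := by
    simpa using W_mul_mem v_mem_W (n := 1) (by simpa using s_mem_W)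
  have hvv : v * v ∈ W ^ 2 := by
    simpa using W_mul_mem v_mem_W (n := 1) (by simpa using v_mem_W)
  refine derivation_mem_V (D := fun k g => d * d * br g (P k)) ?_ ?_ ?_ ?_ ?_ ?_ hg
  · intro k f g
    simp only [map_add, LinearMap.add_apply, mul_add]
  · intro k c f
    simp only [map_smul, LinearMap.smul_apply, mul_smul_comm]
  · intro k f g
    simp only [mul_br]
    ring
  · simp only [br_u_P, mul_zero]
    exact (V 1).zero_mem
  · exact ⟨0, zero_mem _, -(v * s), neg_mem hvs,
      fun k => by simp only [br_s_P]; simp only [hv]; ring⟩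
  · exact ⟨(2 : ℕ) * v, ofNat_mul_mem (by simpa using v_mem_W) 2, -((2 : ℕ) * (v * v)),
      neg_mem (ofNat_mul_mem hvv 2),
      fun k => by simp only [br_v_P]; simp only [hv]; push_cast; ring⟩

theorem mul_d_br_Q_mem_V {i : ℕ} {b g : Obs} (hb : b ∈ W) (hg : g ∈ W ^ i) :
    (fun k => b * (d * br g (Q k))) ∈ V i := by
  have hv : v = d * d * (s * s) := rfl
  have hb' : b ∈ W ^ 1 := by simpa using hb
  refine derivation_mem_V (D := fun k g => b * (d * br g (Q k))) ?_ ?_ ?_ ?_ ?_ ?_ hg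
  · intro k f g
    simp only [map_add, LinearMap.add_apply, mul_add]
  · intro k c f
    simp only [map_smul, LinearMap.smul_apply, mul_smul_comm]
  · intro k f g
    simp only [mul_br]
    ring
  · exact ⟨-((2 : ℕ) * b), neg_mem (ofNat_mul_mem hb' 2), 0, zero_mem _,
      fun k => by simp only [br_u_Q]; push_cast; ring⟩
  · simp only [br_s_Q, mul_zero]
    exact (V 1).zero_mem
  · exact ⟨0, zero_mem _, -((2 : ℕ) * (v * b)), neg_mem (ofNat_mul_mem (W_mul_mem v_mem_W hb') 2),
      fun k => by simp only [br_v_Q]; simp only [hv]; push_cast; ring⟩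

theorem mul_pow_d_br_Q_mem_V {i j : ℕ} {b g : Obs} (hb : b ∈ W ^ (j + 1)) (hg : g ∈ W ^ i) :
    (fun k => b * (d * br g (Q k))) ∈ V (i + j) := by
  rw [pow_succ] at hb
  refine Submodule.mul_induction_on hb (fun x hx z hz => ?_) fun x z hx hz => ?_
  · simp only [mul_assoc x z]
    exact smul_mem_V hx (mul_d_br_Q_mem_V hz hg)
  · simp only [add_mul]
    exact (V _).add_mem hx hz

/-- The Hamiltonian vector field of a generator `(p · q) g` preserves the post-Newtonian form of
vectors, and raises the weight by that of `g`. -/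
theorem br_generator_mem_V {i j : ℕ} {g : Obs} {A : Fin 3 → Obs} (hg : g ∈ W ^ i) (hA : A ∈ V j) :
    (fun k => br (d * g) (A k)) ∈ V (j + i) := by
  obtain ⟨a, ha, b, hb, h⟩ := hA
  have hij : a * g ∈ W ^ (j + i) := mul_mem_W ha hg
  have key : (fun k => br (d * g) (A k)) =
      (fun k => br (d * g) a * (d * P k)) + (fun k => (a * br g d) * (d * P k)) +
        (fun k => a * (d * d * br g (P k))) + (fun k => (a * g) * (d * P k)) +
        (fun k => br (d * g) b * Q k) + (fun k => b * (d * br g (Q k))) +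
        (fun k => (-(b * g)) * Q k) := by
    ext1 k
    simp only [Pi.add_apply, h, map_add, br_mul]
    simp only [mul_br, br_d_P, br_d_Q, br_self]
    ring
  rw [key]
  refine add_mem (add_mem (add_mem (add_mem (add_mem (add_mem ?_ ?_) ?_) ?_) ?_) ?_) ?_
  · exact smul_d_P_mem_V (br_generator_mem hg ha)
  · refine smul_d_P_mem_V (mul_mem_W ha ?_)
    rw [br_antisymm]
    exact neg_mem (br_d_mem hg)
  · rw [add_comm]
    exact smul_mem_V ha (d_d_br_P_mem_V hg)
  · exact smul_d_P_mem_V hij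
  · refine smul_Q_mem_V ?_
    have := br_generator_mem hg hb
    rwa [add_right_comm] at this
  · rw [add_comm]
    exact mul_pow_d_br_Q_mem_V hb hg
  · refine smul_Q_mem_V (neg_mem ?_)
    have := mul_mem_W hb hg
    rwa [add_right_comm] at this

theorem lrlObs_mem_V : lrlObs ∈ V 0 := by
  refine ⟨-1, neg_mem (by rw [pow_zero]; exact Submodule.mem_one.mpr ⟨1, map_one _⟩),
    u - s, ?_, fun k => ?_⟩
  · simpa using W.sub_mem u_mem_W s_mem_W
  · rw [lrlObs]; ring

/-! ### Normal forms modulo total derivatives along the Kepler flow -/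

/-- The total derivative which reduces the power of `1 / r`. -/
theorem br_monomial_E (k m : ℕ) :
    br (d * (y ^ k * s ^ m)) E = (2 * k + m : ℝ) • (y ^ (k + 1) * s ^ m) -
      (4 * k + 2 * m - 1 : ℝ) • (y ^ k * s ^ (m + 1)) -
      (2 * (2 * k + m - 1) : ℝ) • (E * (y ^ k * s ^ m)) := by
  have hy : br (y ^ k) E = -(2 * k : Obs) * d * s * s * y ^ k := by
    rcases k with _ | k
    · simp [br_antisymm 1 E, br_one]
    · rw [br_antisymm, br_pow, br_antisymm E y, br_y_E]
      simp only [Algebra.smul_def, map_add, map_one, map_natCast]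
      push_cast
      ring
  have hs : br (s ^ m) E = -(m : Obs) * d * s * s * s ^ m := by
    rcases m with _ | m
    · simp [br_antisymm 1 E, br_one]
    · rw [br_antisymm, br_pow, br_antisymm E s, br_s_E]
      simp only [Algebra.smul_def, map_add, map_one, map_natCast]
      push_cast
      ring
  have hv : d * d * (s * s) = 2 * E + 2 * s - y := v_eq
  rw [mul_br, mul_br, br_d_E, hy, hs]
  simp only [Algebra.smul_def, map_add, map_sub, map_mul, map_one, map_natCast, map_ofNat]
  linear_combination (-(2 * k + m : Obs) * y ^ k * s ^ m) * hv

/-- The combinations of the products `E ^ k (L² / r²) ^ (n + 1 - k)`, up to total derivatives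
of `(p · q) g` with `g` of weight `n`. -/
def normalForms (n : ℕ) : Submodule ℝ Obs where
  carrier := {x | ∃ (a : ℕ → ℝ) (g : Obs), g ∈ W ^ n ∧
    x = ∑ k ∈ Finset.range (n + 2), a k • (E ^ k * y ^ (n + 1 - k)) + br (d * g) E}
  zero_mem' := ⟨0, 0, zero_mem _, by simp⟩
  add_mem' := by
    rintro _ _ ⟨a, g, hg, rfl⟩ ⟨a', g', hg', rfl⟩
    refine ⟨a + a', g + g', add_mem hg hg', ?_⟩
    simp only [Pi.add_apply, add_smul, Finset.sum_add_distrib, mul_add, map_add,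
      LinearMap.add_apply]
    abel
  smul_mem' := by
    rintro c _ ⟨a, g, hg, rfl⟩
    refine ⟨c • a, c • g, Submodule.smul_mem _ c hg, ?_⟩
    simp only [Pi.smul_apply, smul_eq_mul, mul_smul, ← Finset.smul_sum, mul_smul_comm, map_smul,
      LinearMap.smul_apply, smul_add]

/-- Every form of weight `n + 1` has a normal form. -/
theorem mem_normalForms {n : ℕ} {x : Obs} (hx : x ∈ W ^ (n + 1)) : x ∈ normalForms n := by
  have hyW : y ∈ W := W.sub_mem u_mem_W v_mem_W
  have hmono : ∀ m l k : ℕ, l + k + m = n + 1 → E ^ l * y ^ k * s ^ m ∈ normalForms n := by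
    intro m
    induction m with
    | zero =>
      intro l k h
      refine ⟨Pi.single l 1, 0, zero_mem _, ?_⟩
      rw [Finset.sum_eq_single_of_mem l (Finset.mem_range.mpr (by omega))]
      · simp [show n + 1 - l = k by omega]
      · intro j _ hj
        rw [Pi.single_eq_of_ne hj, zero_smul]
    | succ m ih =>
      intro l k h
      -- The coefficient of the term to be eliminated is an odd integer.
      have hc : (4 * k + 2 * m - 1 : ℝ) ≠ 0 := by
        intro h0
        have : (4 * k + 2 * m : ℤ) = 1 := by
          have : (4 * k + 2 * m : ℝ) = 1 := by linarith
          exact_mod_cast this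
        omega
      have hg : E ^ l * (y ^ k * s ^ m) ∈ W ^ n := by
        rw [show n = l + (k + m) by omega]
        exact mul_mem_W (Submodule.pow_mem_pow W E_mem_W l)
          (mul_mem_W (Submodule.pow_mem_pow W hyW k) (Submodule.pow_mem_pow W s_mem_W m))
      have hE : br (d * (E ^ l * (y ^ k * s ^ m))) E = E ^ l * br (d * (y ^ k * s ^ m)) E := by
        rw [mul_left_comm, mul_br]
        have : br (E ^ l) E = 0 := by
          rcases l with _ | l
          · simp [br_antisymm 1 E, br_one]
          · rw [br_antisymm, br_pow, br_self]; simp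
        rw [this]; ring
      have h3 : br (d * (E ^ l * (y ^ k * s ^ m))) E ∈ normalForms n := ⟨0, _, hg, by simp⟩
      have h1 := ih l (k + 1) (by omega)
      have h2 := ih (l + 1) k (by omega)
      have h4 := sub_mem (sub_mem ((normalForms n).smul_mem (2 * k + m : ℝ) h1)
        ((normalForms n).smul_mem (2 * (2 * k + m - 1) : ℝ) h2)) h3
      rw [← (normalForms n).smul_mem_iff hc]
      convert h4 using 1
      rw [hE, br_monomial_E]
      simp only [Algebra.smul_def]
      ring
  have hWle : W ≤ Submodule.span ℝ {E, y, s} := by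
    have hE : E ∈ Submodule.span ℝ {E, y, s} := Submodule.subset_span (by simp)
    have hy : y ∈ Submodule.span ℝ {E, y, s} := Submodule.subset_span (by simp)
    have hs : s ∈ Submodule.span ℝ {E, y, s} := Submodule.subset_span (by simp)
    have hu : 2 * E + 2 * s ∈ Submodule.span ℝ {E, y, s} :=
      add_mem (ofNat_mul_mem hE 2) (ofNat_mul_mem hs 2)
    refine Submodule.span_le.mpr ?_
    rintro z (rfl | rfl | rfl)
    · rw [u_eq]; exact hu
    · exact hs
    · rw [v_eq]; exact sub_mem hu hy
  have hx' := span_triple_pow_le E y s (n + 1) (pow_le_pow_left' hWle (n + 1) hx)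
  refine Submodule.span_le.mpr ?_ hx'
  rintro _ ⟨l, k, m, h, rfl⟩
  exact hmono m l k h

/-! ### The obstruction: averaging over Kepler ellipses -/

section Averages

open Real intervalIntegral

/-- The Kepler ellipse of eccentricity `e` and unit angular momentum, parametrized by the true
anomaly. -/
def orbit (e f : ℝ) : Pt :=
  (!₂[cos f / (1 + e * cos f), sin f / (1 + e * cos f), 0], !₂[-sin f, e + cos f, 0])

theorem one_add_mul_cos_pos {e : ℝ} (he : |e| < 1) (f : ℝ) : 0 < 1 + e * cos f := by
  have h1 : |e * cos f| ≤ |e| := by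
    rw [abs_mul]
    exact mul_le_of_le_one_right (abs_nonneg e) (abs_cos_le_one f)
  linarith [neg_abs_le (e * cos f)]

theorem radius_orbit {e : ℝ} (he : |e| < 1) (f : ℝ) : radius (orbit e f) = (1 + e * cos f)⁻¹ := by
  have h := one_add_mul_cos_pos he f
  have h2 : radius (orbit e f) ^ 2 = ((1 + e * cos f)⁻¹) ^ 2 := by
    simp [radius, orbit, EuclideanSpace.norm_sq_eq, Fin.sum_univ_three]
    rw [div_pow, div_pow, ← add_div, cos_sq_add_sin_sq, one_div]
  exact (pow_left_inj₀ (norm_nonneg _) (by positivity) two_ne_zero).mp h2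

theorem orbit_mem {e : ℝ} (he : |e| < 1) (f : ℝ) : orbit e f ∈ phaseSpace := by
  have h : radius (orbit e f) ≠ 0 := by
    rw [radius_orbit he]
    exact inv_ne_zero (one_add_mul_cos_pos he f).ne'
  exact norm_ne_zero_iff.mp h

/-- The value of an observable along the ellipse. -/
def along {e : ℝ} (he : |e| < 1) (f : ℝ) : Obs →ₐ[ℝ] ℝ :=
  (Pi.evalAlgHom ℝ (fun _ : phaseSpace => ℝ) ⟨orbit e f, orbit_mem he f⟩).comp obsSubalgebra.val

theorem along_eq {e : ℝ} (he : |e| < 1) (f : ℝ) {F : Pt → ℝ} {g : Obs} (h : Rep F g) :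
    along he f g = F (orbit e f) := (h.2 ⟨orbit e f, orbit_mem he f⟩).symm

/-- A curve in three-space is differentiable if its coordinates are. -/
theorem hasDerivAt_vec {γ : ℝ → Vec} {γ' : Vec} {f : ℝ}
    (h : ∀ i, HasDerivAt (fun f => γ f i) (γ' i) f) : HasDerivAt γ γ' f := by
  rw [← hasDerivWithinAt_univ, hasDerivWithinAt_iff_hasFDerivWithinAt,
    hasFDerivWithinAt_euclidean]
  intro i
  refine (hasDerivWithinAt_iff_hasFDerivWithinAt.mp (h i).hasDerivWithinAt).congr_fderiv ?_
  ext
  simp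

theorem along_s {e : ℝ} (he : |e| < 1) (f : ℝ) : along he f s = 1 + e * cos f := by
  rw [along_eq he f rep_s, radius_orbit he, inv_inv]

theorem along_d {e : ℝ} (he : |e| < 1) (f : ℝ) :
    along he f d = e * sin f / (1 + e * cos f) := by
  rw [along_eq he f rep_d]
  simp [orbit, Fin.sum_univ_three, dotPQ, PiLp.inner_apply]
  ring

theorem hasDerivAt_orbit {e : ℝ} (he : |e| < 1) (f : ℝ) :
    HasDerivAt (orbit e) (!₂[-sin f / (1 + e * cos f) ^ 2, (e + cos f) / (1 + e * cos f) ^ 2, 0],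
      !₂[-cos f, -sin f, 0]) f := by
  have h := (one_add_mul_cos_pos he f).ne'
  have hden : HasDerivAt (fun f => 1 + e * cos f) (e * -sin f) f :=
    ((hasDerivAt_cos f).const_mul e).const_add 1
  refine HasDerivAt.prodMk ?_ ?_
  · refine hasDerivAt_vec fun i => ?_
    fin_cases i
    · refine ((hasDerivAt_cos f).div hden h).congr_deriv ?_
      simp; field_simp; ring
    · refine ((hasDerivAt_sin f).div hden h).congr_deriv ?_
      simp; congr 1; linear_combination e * sin_sq_add_cos_sq f
    · exact hasDerivAt_const f 0
  · refine hasDerivAt_vec fun i => ?_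
    fin_cases i
    · exact (hasDerivAt_sin f).neg
    · exact (hasDerivAt_cos f).const_add e
    · exact hasDerivAt_const f 0

theorem dp_E (i : Fin 3) : dp i E = P i := by
  apply two_mul_cancel
  have h : dp i u = 2 * P i := by
    simp only [u, map_add, Derivation.leibniz, dp_P, smul_eq_mul]
    fin_cases i <;> simp <;> ring
  have h2 := congrArg (dp i) u_eq
  simp only [two_mul, map_add, dp_s] at h h2 ⊢
  rw [← h, h2]; ring

theorem dq_E (i : Fin 3) : dq i E = s * s * s * Q i := by
  have h : dq i u = 0 := by
    simp only [u, map_add, Derivation.leibniz, dq_P]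
    simp
  rw [E, Derivation.map_sub, Derivation.map_smul, h, dq_s]
  simp

/-- The orbital derivative: `d/df = r² {·, E}` at unit angular momentum. -/
theorem hasDerivAt_along {e : ℝ} (he : |e| < 1) (C : Obs) (f : ℝ) :
    HasDerivAt (fun f => along he f C) ((1 + e * cos f)⁻¹ ^ 2 * along he f (br C E)) f := by
  obtain ⟨F, hF⟩ := exists_rep C
  have h0 := (one_add_mul_cos_pos he f).ne'
  have h1 := (hF.differentiableAt (orbit_mem he f)).hasFDerivAt.comp_hasDerivAt f
    (hasDerivAt_orbit he f)
  have h2 : (fun f => along he f C) = F ∘ orbit e := funext fun f => along_eq he f hF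
  have hq : ∀ i, along he f (dq i C) = fderiv ℝ F (orbit e f) (EuclideanSpace.single i 1, 0) :=
    fun i => along_eq he f (hF.dir _)
  have hp : ∀ i, along he f (dp i C) = fderiv ℝ F (orbit e f) (0, EuclideanSpace.single i 1) :=
    fun i => along_eq he f (hF.dir _)
  have hvec : ∀ a b a' b' : ℝ, ((!₂[a, b, 0], !₂[a', b', 0]) : Pt) =
      a • (EuclideanSpace.single 0 1, 0) + b • (EuclideanSpace.single 1 1, 0) +
      (a' • (0, EuclideanSpace.single 0 1) + b' • (0, EuclideanSpace.single 1 1)) := by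
    intro a b a' b'
    ext i <;> fin_cases i <;> simp
  rw [h2]
  refine h1.congr_deriv ?_
  rw [hvec, map_add, map_add, map_add, map_smul, map_smul, map_smul, map_smul, ← hq, ← hq, ← hp,
    ← hp]
  simp only [br_apply, dp_E, dq_E, map_add, map_sub, map_mul, Fin.sum_univ_three, along_s,
    along_eq he f (rep_Q _), along_eq he f (rep_P _), smul_eq_mul]
  simp [orbit]
  field_simp
  ring

theorem continuous_along {e : ℝ} (he : |e| < 1) (C : Obs) : Continuous fun f => along he f C :=
  continuous_iff_continuousAt.mpr fun f => (hasDerivAt_along he C f).continuousAt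

/-- Total derivatives along the Kepler flow average to zero. -/
theorem integral_along_br_E {e : ℝ} (he : |e| < 1) (C : Obs) :
    ∫ f in (0 : ℝ)..2 * π, (1 + e * cos f)⁻¹ ^ 2 * along he f (br C E) = 0 := by
  rw [integral_eq_sub_of_hasDerivAt (fun f _ => hasDerivAt_along he C f)]
  · rw [sub_eq_zero]
    obtain ⟨F, hF⟩ := exists_rep C
    simp [along_eq he _ hF, orbit]
  · refine Continuous.intervalIntegrable ?_ _ _
    have := continuous_along he (br C E)
    have h0 : ∀ f, 1 + e * cos f ≠ 0 := fun f => (one_add_mul_cos_pos he f).ne'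
    fun_prop (disch := simpa using h0)

theorem along_E {e : ℝ} (he : |e| < 1) (f : ℝ) : along he f E = (e ^ 2 - 1) / 2 := by
  rw [along_eq he f rep_E, kepler, radius_orbit he]
  simp [orbit, EuclideanSpace.norm_sq_eq, Fin.sum_univ_three]
  linear_combination (1 / 2) * sin_sq_add_cos_sq f

theorem along_y {e : ℝ} (he : |e| < 1) (f : ℝ) : along he f y = (1 + e * cos f) ^ 2 := by
  have h0 := (one_add_mul_cos_pos he f).ne'
  rw [y, map_sub, along_eq he f rep_u, v, map_mul, map_mul, map_mul, along_d, along_s]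
  simp [orbit, EuclideanSpace.norm_sq_eq, Fin.sum_univ_three]
  field_simp
  linear_combination (1 - e ^ 2) * sin_sq_add_cos_sq f

/-- The value of `r² {L² / r², A}` along the ellipse, for the component `A` of the
Laplace-Runge-Lenz vector orthogonal to the axis of the ellipse in its plane. -/
theorem along_br_y {e : ℝ} (he : |e| < 1) (f : ℝ) :
    (1 + e * cos f)⁻¹ ^ 2 * along he f (br y (lrlObs 1)) = 2 * ((1 + e * cos f) * cos f - e) := by
  have h0 := (one_add_mul_cos_pos he f).ne'
  rw [br_y_lrlObs]
  simp only [map_sub, map_mul, map_add, along_y, map_ofNat, along_eq he f (rep_Q _),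
    along_eq he f (rep_P _), along_s, along_d]
  simp [orbit]
  field_simp
  linear_combination (-e * (2 + e * cos f)) * sin_sq_add_cos_sq f

/-- The integral of `r² {(L² / r²) ^ (m + 1), A}` over the ellipse of eccentricity `e`, divided by
`2 (m + 1)`, with the component `A` of the Laplace-Runge-Lenz vector as in `along_br_y`. -/
def ellipseIntegral (m : ℕ) (e : ℝ) : ℝ :=
  ∫ f in (0 : ℝ)..2 * π, (1 + e * cos f) ^ (2 * m) * ((1 + e * cos f) * cos f - e)

theorem continuous_ellipseIntegral (m : ℕ) : Continuous (ellipseIntegral m) := by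
  unfold ellipseIntegral
  apply intervalIntegral.continuous_parametric_intervalIntegral_of_continuous'
  simp only [Function.uncurry_def]
  fun_prop

theorem integral_one_add_cos_pow_succ (n : ℕ) :
    (n + 1) * ∫ f in (0 : ℝ)..2 * π, (1 + cos f) ^ (n + 1) =
      (2 * n + 1) * ∫ f in (0 : ℝ)..2 * π, (1 + cos f) ^ n := by
  have h : ∀ f : ℝ, HasDerivAt (fun f => sin f * (1 + cos f) ^ n)
      ((n + 1) * (1 + cos f) ^ (n + 1) - (2 * n + 1) * (1 + cos f) ^ n) f := by
    intro f
    refine ((hasDerivAt_sin f).mul (((hasDerivAt_cos f).const_add 1).pow n)).congr_deriv ?_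
    rcases n with _ | n
    · simp
    · simp only [Nat.add_sub_cancel, Nat.cast_add, Nat.cast_one, Pi.pow_apply]
      linear_combination (-(n + 1) * (1 + cos f) ^ n) * sin_sq_add_cos_sq f
  have h0 := integral_eq_sub_of_hasDerivAt (a := 0) (b := 2 * π) (fun f _ => h f)
    (Continuous.intervalIntegrable (by fun_prop) _ _)
  rw [intervalIntegral.integral_sub (Continuous.intervalIntegrable (by fun_prop) _ _)
    (Continuous.intervalIntegrable (by fun_prop) _ _), intervalIntegral.integral_const_mul,
    intervalIntegral.integral_const_mul] at h0
  simp only [sin_two_pi, sin_zero, zero_mul, sub_zero] at h0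
  linarith

/-- In the parabolic limit the integrals do not vanish: the recursion for the integrals of
`(1 + cos f) ^ n` expresses them as a nonzero multiple of that of `(1 + cos f) ^ (2 m)`. -/
theorem ellipseIntegral_one_ne_zero (m : ℕ) : ellipseIntegral m 1 ≠ 0 := by
  have hpos : 0 < ∫ f in (0 : ℝ)..2 * π, (1 + cos f) ^ (2 * m) := by
    refine intervalIntegral.integral_pos (by positivity) (by fun_prop)
      (fun f _ => pow_nonneg (by linarith [neg_one_le_cos f]) _)
      ⟨0, ⟨le_rfl, by positivity⟩, by simp⟩
  have hJ : ellipseIntegral m 1 = (∫ f in (0 : ℝ)..2 * π, (1 + cos f) ^ (2 * m + 1 + 1)) -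
      (∫ f in (0 : ℝ)..2 * π, (1 + cos f) ^ (2 * m + 1)) -
      ∫ f in (0 : ℝ)..2 * π, (1 + cos f) ^ (2 * m) := by
    rw [← intervalIntegral.integral_sub (Continuous.intervalIntegrable (by fun_prop) _ _)
      (Continuous.intervalIntegrable (by fun_prop) _ _),
      ← intervalIntegral.integral_sub (Continuous.intervalIntegrable (by fun_prop) _ _)
      (Continuous.intervalIntegrable (by fun_prop) _ _), ellipseIntegral]
    refine intervalIntegral.integral_congr fun f _ => ?_
    ring
  have h1 := integral_one_add_cos_pow_succ (2 * m)
  have h2 := integral_one_add_cos_pow_succ (2 * m + 1)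
  push_cast at h1 h2
  have h3 : (2 * m + 2) * ellipseIntegral m 1 =
      (2 * m - 1) * ∫ f in (0 : ℝ)..2 * π, (1 + cos f) ^ (2 * m) := by
    rw [hJ]
    linear_combination h2 + h1
  have h4 : (2 * m - 1 : ℝ) ≠ 0 := by
    intro h
    have : (2 * m : ℤ) = 1 := by
      have : (2 * m : ℝ) = 1 := by linarith
      exact_mod_cast this
    omega
  intro h
  rw [h, mul_zero] at h3
  exact mul_ne_zero h4 hpos.ne' h3.symm

/-- A combination of `E ^ k (L² / r²) ^ (n + 1 - k)`, `k ≤ n`, whose bracket with the second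
component of the Laplace-Runge-Lenz vector is a total derivative along the Kepler flow, is zero. -/
theorem coeff_eq_zero_of_br_lrlObs {n : ℕ} {b : ℕ → ℝ} {C : Obs}
    (h : br (∑ k ∈ Finset.range (n + 1), b k • (E ^ k * y ^ (n + 1 - k))) (lrlObs 1) = br C E) :
    ∀ j < n + 1, b j = 0 := by
  have hbr : ∀ k ∈ Finset.range (n + 1), br (b k • (E ^ k * y ^ (n + 1 - k))) (lrlObs 1) =
      (b k * (n - k + 1 : ℕ)) • (E ^ k * (y ^ (n - k) * br y (lrlObs 1))) := by
    intro k hk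
    rw [Finset.mem_range] at hk
    have hE : br (E ^ k) (lrlObs 1) = 0 := by
      rcases k with _ | k
      · rw [pow_zero, br_antisymm, br_one, neg_zero]
      · rw [br_antisymm, br_pow, br_antisymm, br_E_lrlObs]; simp
    rw [map_smul, LinearMap.smul_apply, mul_br, hE, show n + 1 - k = n - k + 1 by omega,
      br_antisymm (y ^ _), br_pow, br_antisymm _ y, mul_smul]
    simp only [Algebra.smul_def, map_add, map_one, map_natCast]
    push_cast
    ring
  rw [map_sum, LinearMap.sum_apply, Finset.sum_congr rfl hbr] at h
  -- The orbital averages, at unit angular momentum, where `E = (e ^ 2 - 1) / 2`.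
  have hsum : ∀ e : ℝ, |e| < 1 → ∑ k ∈ Finset.range (n + 1),
      b k * (n - k + 1 : ℕ) * ((e ^ 2 - 1) / 2) ^ k * ellipseIntegral (n - k) e = 0 := by
    intro e he
    have hI := integral_along_br_E he C
    rw [← h] at hI
    have hint : ∀ f, (1 + e * cos f)⁻¹ ^ 2 * along he f (∑ k ∈ Finset.range (n + 1),
        (b k * (n - k + 1 : ℕ)) • (E ^ k * (y ^ (n - k) * br y (lrlObs 1)))) =
        2 * ∑ k ∈ Finset.range (n + 1), b k * (n - k + 1 : ℕ) * ((e ^ 2 - 1) / 2) ^ k *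
          ((1 + e * cos f) ^ (2 * (n - k)) * ((1 + e * cos f) * cos f - e)) := by
      intro f
      rw [map_sum, Finset.mul_sum, Finset.mul_sum]
      refine Finset.sum_congr rfl fun k _ => ?_
      rw [map_smul, map_mul, map_mul, map_pow, map_pow, along_E, along_y, smul_eq_mul, ← pow_mul]
      linear_combination (b k * (n - k + 1 : ℕ) * ((e ^ 2 - 1) / 2) ^ k *
        (1 + e * cos f) ^ (2 * (n - k))) * along_br_y he f
    simp only [hint] at hI
    rw [intervalIntegral.integral_const_mul, intervalIntegral.integral_finsetSum] at hI
    · simp only [intervalIntegral.integral_const_mul] at hI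
      simpa [ellipseIntegral] using hI
    · exact fun k _ => Continuous.intervalIntegrable (by fun_prop) _ _
  intro j
  induction j using Nat.strong_induction_on with
  | _ j ih =>
    intro hj
    -- After division by the common factor `E ^ j`, only the `j`-th term survives at `e = 1`.
    let g : ℝ → ℝ := fun e => ∑ k ∈ Finset.range (n + 1),
      b k * (n - k + 1 : ℕ) * ((e ^ 2 - 1) / 2) ^ (k - j) * ellipseIntegral (n - k) e
    have hg : Continuous g := by
      have := continuous_ellipseIntegral
      fun_prop
    have hg0 : ∀ e ∈ Set.Ioo (0 : ℝ) 1, g e = 0 := by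
      rintro e ⟨he0, he1⟩
      have hx : (e ^ 2 - 1) / 2 ≠ 0 := by nlinarith
      have := hsum e (by rw [abs_of_pos he0]; exact he1)
      refine (mul_eq_zero.mp (?_ : ((e ^ 2 - 1) / 2) ^ j * g e = 0)).resolve_left (pow_ne_zero j hx)
      rw [← this, Finset.mul_sum]
      refine Finset.sum_congr rfl fun k hk => ?_
      rcases lt_or_ge k j with hkj | hkj
      · rw [ih k hkj (hkj.trans hj)]; ring
      · rw [← Nat.add_sub_of_le hkj, pow_add, Nat.add_sub_cancel_left]
        ring
    have hg1 : g 1 = 0 := by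
      have hcl : closure (Set.Ioo (0 : ℝ) 1) ⊆ {e | g e = 0} :=
        closure_minimal hg0 (isClosed_eq hg continuous_const)
      exact hcl (by rw [closure_Ioo zero_ne_one]; exact ⟨zero_le_one, le_rfl⟩)
    have hg1' : g 1 = b j * (n - j + 1 : ℕ) * ellipseIntegral (n - j) 1 := by
      simp only [g]
      rw [Finset.sum_eq_single_of_mem j (Finset.mem_range.mpr hj)]
      · simp
      · intro k hk hkj
        rcases lt_or_gt_of_ne hkj with hkj | hkj
        · rw [ih k hkj (hkj.trans hj)]; ring
        · rw [show ((1 : ℝ) ^ 2 - 1) / 2 = 0 by norm_num, zero_pow (by omega)]; ring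
    rw [hg1'] at hg1
    simpa [ellipseIntegral_one_ne_zero, Nat.cast_add_one_ne_zero] using hg1

end Averages

/-! ### Chains of Lie transforms on series of observables -/

/-- The composite `exp(ε ^ n {G_n, ·}) ⋯ exp(ε {G₁, ·})` on formal series of observables. -/
def chain (G : ℕ → Obs) : ℕ → ((ℕ → Obs) →ₗ[ℝ] (ℕ → Obs))
  | 0 => LinearMap.id
  | n + 1 => expSeries (n + 1) (br (G (n + 1))) ∘ₗ chain G n

theorem chain_conv (G : ℕ → Obs) {B : Obs →ₗ[ℝ] Obs →ₗ[ℝ] Obs}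
    (hB : ∀ g f f', br g (B f f') = B (br g f) f' + B f (br g f')) (n : ℕ) (F F' : ℕ → Obs) :
    chain G n (conv B F F') = conv B (chain G n F) (chain G n F') := by
  induction n with
  | zero => rfl
  | succ n ih =>
    simp only [chain, LinearMap.comp_apply]
    rw [ih, expSeries_conv B _ (hB _) (by omega)]

theorem unitriangular_chain (G : ℕ → Obs) (n : ℕ) : Unitriangular (chain G n) := by
  induction n with
  | zero => exact fun F n hF => ⟨hF, rfl⟩
  | succ n ih => exact (unitriangular_expSeries (by omega) _).comp ih

theorem epsLinear_chain (G : ℕ → Obs) (n : ℕ) : EpsLinear (chain G n) := by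
  induction n with
  | zero =>
    intro F k
    rw [Finset.sum_eq_single_of_mem (k, 0) (by simp)]
    · simp [chain]
    · rintro ⟨a, b⟩ h hab
      have hb : b ≠ 0 := by rintro rfl; simp_all
      simp [chain, hb]
  | succ n ih => exact (epsLinear_expSeries (by omega) _).comp ih

theorem chain_congr {G G' : ℕ → Obs} {n : ℕ} (h : ∀ i ≤ n, G i = G' i) :
    chain G n = chain G' n := by
  induction n with
  | zero => rfl
  | succ n ih => rw [chain, chain, ih fun i hi => h i (by omega), h (n + 1) le_rfl]

theorem Rep.iterate_pb {F G : Pt → ℝ} {f g : Obs} (hG : Rep G g) (hF : Rep F f) (m : ℕ) :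
    Rep ((PNKepler.pb G)^[m] F) ((br g ^ m : Module.End ℝ Obs) f) := by
  induction m with
  | zero => exact hF
  | succ m ih =>
    rw [Function.iterate_succ_apply', pow_succ', Module.End.mul_apply]
    exact hG.pb ih

theorem rep_lieTransform {i : ℕ} {G : Pt → ℝ} {g : Obs} (hG : Rep G g) {F : ℕ → Pt → ℝ}
    {f : ℕ → Obs} (hF : ∀ k, Rep (F k) (f k)) (k : ℕ) :
    Rep (lieTransform i G F k) (expSeries i (br g) f k) :=
  Rep.sum fun _ _ => (hG.iterate_pb (hF _) _).smul _

theorem rep_lieChain {G : ℕ → Pt → ℝ} {g : ℕ → Obs} (hG : ∀ i, Rep (G i) (g i))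
    {F : ℕ → Pt → ℝ} {f : ℕ → Obs} (hF : ∀ k, Rep (F k) (f k)) (n k : ℕ) :
    Rep (lieChain G n F k) (chain g n f k) := by
  induction n generalizing k with
  | zero => exact hF k
  | succ n ih => exact rep_lieTransform (hG _) ih k

theorem expSeries_mem {R : Type*} [AddCommGroup R] [Module ℝ R] {M : ℕ → Submodule ℝ R} {i : ℕ}
    {D : Module.End ℝ R} (hD : ∀ w, ∀ x ∈ M w, D x ∈ M (w + i)) {F : ℕ → R}
    (hF : ∀ k, F k ∈ M k) (k : ℕ) : expSeries i D F k ∈ M k := by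
  have hpow : ∀ m w, ∀ x ∈ M w, (D ^ m) x ∈ M (w + i * m) := by
    intro m
    induction m with
    | zero => exact fun w x hx => hx
    | succ m ih =>
      intro w x hx
      rw [pow_succ', Module.End.mul_apply, mul_add, mul_one, ← add_assoc]
      exact hD _ _ (ih w x hx)
  simp only [expSeries, LinearMap.coe_mk, AddHom.coe_mk]
  refine (M k).sum_mem fun m hm => (M k).smul_mem _ ?_
  have := hpow m _ _ (hF (k - i * m))
  rwa [Nat.sub_add_cancel (Finset.mem_filter.mp hm).2] at this

theorem chain_mem_W {g : ℕ → Obs} (hg : ∀ i, g i ∈ W ^ i) {F : ℕ → Obs}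
    (hF : ∀ k, F k ∈ W ^ (k + 1)) (n k : ℕ) :
    chain (fun i => d * g i) n F k ∈ W ^ (k + 1) := by
  induction n generalizing k with
  | zero => exact hF k
  | succ n ih =>
    refine expSeries_mem (M := fun k => W ^ (k + 1)) (fun w x hx => ?_) ih k
    rw [add_right_comm]
    exact br_generator_mem (hg _) hx

theorem chain_mem_V {g : ℕ → Obs} (hg : ∀ i, g i ∈ W ^ i) {A : ℕ → Fin 3 → Obs}
    (hA : ∀ k, A k ∈ V k) (n k : ℕ) :
    (fun i => chain (fun i => d * g i) n (fun k => A k i) k) ∈ V k := by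
  induction n generalizing k with
  | zero => exact hA k
  | succ n ih =>
    have hpow : ∀ (D : Module.End ℝ Obs) (m : ℕ) (B : Fin 3 → Obs) (i : Fin 3),
        ((LinearMap.compLeft (D : Obs →ₗ[ℝ] Obs) (Fin 3) : Module.End ℝ (Fin 3 → Obs)) ^ m) B i =
          (D ^ m) (B i) := by
      intro D m B i
      induction m with
      | zero => rfl
      | succ m ih =>
        rw [pow_succ', pow_succ', Module.End.mul_apply, Module.End.mul_apply, ← ih]
        rfl
    have := expSeries_mem (M := V) (i := n + 1)
      (D := LinearMap.compLeft (br (d * g (n + 1))) (Fin 3))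
      (fun w x hx => br_generator_mem_V (hg _) hx) ih k
    convert this using 1
    ext1 i
    simp only [chain, LinearMap.comp_apply, expSeries, LinearMap.coe_mk, AddHom.coe_mk,
      Finset.sum_apply, Pi.smul_apply, hpow]

/-- The series `ε⁻¹ τ(ε H)` of the rescaled Kepler Hamiltonian. -/
def rescaled (δ : ℕ → ℝ) (n : ℕ) : Obs := δ n • E ^ (n + 1)

theorem rep_rescaled (δ : ℕ → ℝ) (n : ℕ) : Rep (rescaledKepler δ n) (rescaled δ n) :=
  (rep_E.pow (n + 1)).smul (δ n)

theorem rescaled_mem (δ : ℕ → ℝ) (n : ℕ) : rescaled δ n ∈ W ^ (n + 1) :=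
  Submodule.smul_mem _ _ (Submodule.pow_mem_pow W E_mem_W (n + 1))

theorem br_rescaled_lrlObs (δ : ℕ → ℝ) (n : ℕ) (i : Fin 3) : br (rescaled δ n) (lrlObs i) = 0 := by
  rw [rescaled, map_smul, LinearMap.smul_apply, br_antisymm, br_pow, br_antisymm, br_E_lrlObs]
  simp

/-- The bracket of a rescaled Kepler Hamiltonian with anything is a total derivative along the
Kepler flow. -/
theorem exists_conv_br_rescaled (δ : ℕ → ℝ) (B : ℕ → Obs) (k : ℕ) :
    ∃ C, conv br (rescaled δ) B k = br C E := by
  refine ⟨-∑ p ∈ Finset.HasAntidiagonal.antidiagonal k,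
    (δ p.1 * (p.1 + 1)) • (E ^ p.1 * B p.2), ?_⟩
  rw [map_neg, LinearMap.neg_apply, ← br_antisymm, map_sum, conv]
  refine Finset.sum_congr rfl fun p _ => ?_
  rw [rescaled, map_smul, map_smul, LinearMap.smul_apply, br_antisymm, br_pow, br_mul,
    br_antisymm (B _) E, mul_smul]
  have : br E (E ^ p.1) = 0 := by
    rcases p.1 with _ | m
    · rw [pow_zero, br_one]
    · rw [br_pow, br_self]; simp
  rw [this]
  simp only [Algebra.smul_def]
  ring

/-! ### From conserved vectors to canonical transformations -/

/-- If the second component of the Laplace-Runge-Lenz vector extends to a conserved series, then the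
Hamiltonian is a rescaled Kepler Hamiltonian up to post-Newtonian Lie transforms. -/
theorem exists_chain_of_conserved {h A : ℕ → Obs} (h0 : h 0 = E) (hW : ∀ k, h k ∈ W ^ (k + 1))
    (hA0 : A 0 = lrlObs 1) (N : ℕ) (hcons : ∀ k ≤ N, conv br h A k = 0) :
    ∃ (δ : ℕ → ℝ) (g : ℕ → Obs), δ 0 = 1 ∧ (∀ i, g i ∈ W ^ i) ∧
      ∀ k ≤ N, h k = chain (fun i => d * g i) N (rescaled δ) k := by
  induction N with
  | zero =>
    refine ⟨fun _ => 1, fun _ => 0, rfl, fun i => zero_mem _, fun k hk => ?_⟩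
    obtain rfl : k = 0 := by omega
    simp [chain, rescaled, h0]
  | succ N ih =>
    obtain ⟨δ, g, hδ, hg, hN⟩ := ih fun k hk => hcons k (by omega)
    obtain ⟨a, γ, hγ, ha⟩ := mem_normalForms (n := N + 1)
      (sub_mem (hW (N + 1)) (chain_mem_W hg (rescaled_mem δ) N (N + 1)))
    rw [Finset.sum_range_succ, show N + 1 + 1 - (N + 1 + 1) = 0 by omega, pow_zero, mul_one] at ha
    set Y := ∑ k ∈ Finset.range (N + 1 + 1), a k • (E ^ k * y ^ (N + 1 + 1 - k)) with hY
    -- The part `E ^ (N + 2)` of the normal form is absorbed in `τ`, and the total derivative in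
    -- the generator of order `N + 1`.
    let δ' : ℕ → ℝ := Function.update δ (N + 1) (δ (N + 1) + a (N + 1 + 1))
    let g' : ℕ → Obs := Function.update g (N + 1) γ
    let Φ := chain (fun i => d * g' i) (N + 1)
    have hg' : ∀ i, g' i ∈ W ^ i := by
      intro i
      rcases eq_or_ne i (N + 1) with rfl | hi
      · simpa [g'] using hγ
      · simpa [g', hi] using hg i
    have hΦ : Unitriangular Φ := unitriangular_chain _ _
    have hδρ : rescaled δ' = rescaled δ + Pi.single (N + 1) (a (N + 1 + 1) • E ^ (N + 1 + 1)) := by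
      ext1 i
      rcases eq_or_ne i (N + 1) with rfl | hi
      · simp [rescaled, δ', add_smul]
      · simp [rescaled, δ', hi]
    have hchain : chain (fun i => d * g' i) N = chain (fun i => d * g i) N :=
      chain_congr fun i hi => by simp [g', show i ≠ N + 1 by omega]
    have htri := unitriangular_chain (fun i => d * g i) N
      (Pi.single (N + 1) (a (N + 1 + 1) • E ^ (N + 1 + 1))) (N + 1)
      fun k hk => Pi.single_eq_of_ne hk.ne _
    have hlow : ∀ k < N + 1, Φ (rescaled δ') k = h k := by
      intro k hk
      simp only [Φ, chain, LinearMap.comp_apply]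
      rw [expSeries_apply_of_lt _ _ hk, hchain, hδρ, map_add, Pi.add_apply, htri.1 k hk,
        add_zero, hN k (by omega)]
    have htop : h (N + 1) = Φ (rescaled δ') (N + 1) + Y := by
      have hlead : chain (fun i => d * g' i) N (rescaled δ') 0 = E := by
        rw [hchain, hδρ, map_add, Pi.add_apply, htri.1 0 (by omega), add_zero,
          ← hN 0 (by omega), h0]
      have hexp : Φ (rescaled δ') (N + 1) =
          chain (fun i => d * g' i) N (rescaled δ') (N + 1) + br (d * g' (N + 1)) E := by
        simp only [Φ, chain, LinearMap.comp_apply]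
        rw [expSeries_apply_self (by omega), hlead]
      rw [hexp, hchain, hδρ, map_add, Pi.add_apply, htri.2, Pi.single_eq_same]
      rw [sub_eq_iff_eq_add] at ha
      rw [ha]
      simp only [g', Function.update_self]
      abel
    -- Pulling the conserved series back by `Φ` shows that `{Y, A₀}` is a total derivative.
    obtain ⟨B, hB⟩ := hΦ.exists_preimage A (N + 1 + 1)
    have hconv : ∀ k < N + 1 + 1, Φ (conv br (rescaled δ') B) k =
        conv br (Φ (rescaled δ')) A k := by
      intro k hk
      rw [chain_conv _ br_jacobi]
      refine Finset.sum_congr rfl fun p hp => ?_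
      rw [Finset.HasAntidiagonal.mem_antidiagonal] at hp
      rw [hB p.2 (by omega)]
    have hlowconv : ∀ k < N + 1, Φ (conv br (rescaled δ') B) k = 0 := by
      intro k hk
      rw [hconv k (by omega), ← hcons k (by omega)]
      refine Finset.sum_congr rfl fun p hp => ?_
      rw [Finset.HasAntidiagonal.mem_antidiagonal] at hp
      rw [hlow p.1 (by omega)]
    have htopconv : Φ (conv br (rescaled δ') B) (N + 1) = -br Y (lrlObs 1) := by
      have hc := hcons (N + 1) le_rfl
      rw [hconv _ (by omega)]
      simp only [conv, Finset.Nat.antidiagonal_succ', Finset.sum_cons, Finset.sum_map] at hc ⊢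
      rw [htop, map_add, LinearMap.add_apply, hA0] at hc
      rw [hA0, eq_neg_iff_add_eq_zero, add_right_comm, hc.symm]
      congr 1
      refine Finset.sum_congr rfl fun p hp => ?_
      rw [Finset.HasAntidiagonal.mem_antidiagonal] at hp
      simp only [Function.Embedding.prodMap, Function.Embedding.coeFn_mk, Prod.map,
        Function.Embedding.refl_apply]
      rw [hlow p.1 (by omega)]
    obtain ⟨C, hC⟩ := exists_conv_br_rescaled δ' B (N + 1)
    rw [← (hΦ _ (N + 1) (hΦ.eq_zero hlowconv)).2, htopconv] at hC
    have hYC : br Y (lrlObs 1) = br (-C) E := by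
      rw [map_neg, LinearMap.neg_apply, ← hC, neg_neg]
    have hY0 : Y = 0 := Finset.sum_eq_zero fun k hk => by
      rw [coeff_eq_zero_of_br_lrlObs hYC k (Finset.mem_range.mp hk), zero_smul]
    refine ⟨δ', g', by simp [δ', hδ], hg', fun k hk => ?_⟩
    rcases Nat.lt_succ_iff_lt_or_eq.mp (Nat.lt_succ_of_le hk) with hk | rfl
    · exact (hlow k hk).symm
    · rw [htop, hY0, add_zero]

/-! ### Post-Newtonian forms as elements of the graded pieces -/

/-- The observable given by the form of weight `w` with coefficients `c`. -/
def pnObs (w : ℕ) (c : ℕ → ℕ → ℕ → ℝ) : Obs :=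
  ∑ a ∈ Finset.HasAntidiagonal.antidiagonal w, ∑ b ∈ Finset.HasAntidiagonal.antidiagonal a.2,
    c a.1 b.1 b.2 • (u ^ a.1 * s ^ b.1 * v ^ b.2)

theorem rep_pnForm (w : ℕ) (c : ℕ → ℕ → ℕ → ℝ) : Rep (pnForm w c) (pnObs w c) := by
  refine (Rep.sum fun a _ => Rep.sum fun b _ =>
    ((((rep_u.pow a.1).mul (rep_s.pow b.1)).mul (rep_v.pow b.2)).smul (c a.1 b.1 b.2))).congr
      fun x _ => ?_
  simp only [pnForm, Finset.sum_apply]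
  refine Finset.sum_congr rfl fun a _ => Finset.sum_congr rfl fun b _ => ?_
  simp only [Pi.smul_apply, Pi.mul_apply, Pi.pow_apply, smul_eq_mul, inv_pow]
  ring

theorem pnObs_mem (w : ℕ) (c : ℕ → ℕ → ℕ → ℝ) : pnObs w c ∈ W ^ w := by
  refine (W ^ w).sum_mem fun a ha => (W ^ w).sum_mem fun b hb => (W ^ w).smul_mem _ ?_
  rw [Finset.HasAntidiagonal.mem_antidiagonal] at ha hb
  rw [show w = a.1 + b.1 + b.2 by omega]
  exact mul_mem_W (mul_mem_W (Submodule.pow_mem_pow W u_mem_W _)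
    (Submodule.pow_mem_pow W s_mem_W _)) (Submodule.pow_mem_pow W v_mem_W _)

theorem exists_pnObs_eq {w : ℕ} {f : Obs} (hf : f ∈ W ^ w) : ∃ c, pnObs w c = f := by
  have hf' := span_triple_pow_le u s v w hf
  refine Submodule.span_induction ?_ ?_ ?_ ?_ hf'
  · rintro _ ⟨l, m, n, rfl, rfl⟩
    refine ⟨fun l' m' n' => if l' = l ∧ m' = m ∧ n' = n then 1 else 0, ?_⟩
    rw [pnObs, Finset.sum_eq_single_of_mem (l, m + n) (by simp; ring),
      Finset.sum_eq_single_of_mem (m, n) (by simp)]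
    · simp
    · rintro ⟨b, b'⟩ _ hb
      rw [if_neg (by rintro ⟨-, rfl, rfl⟩; exact hb rfl), zero_smul]
    · rintro ⟨a, a'⟩ ha hne
      refine Finset.sum_eq_zero fun b hb => ?_
      rw [Finset.HasAntidiagonal.mem_antidiagonal] at ha hb
      simp only at ha hb
      rw [if_neg, zero_smul]
      rintro ⟨rfl, h1, h2⟩
      exact hne (by rw [← hb, h1, h2])
  · exact ⟨0, by simp [pnObs]⟩
  · rintro _ _ _ _ ⟨c, rfl⟩ ⟨c', rfl⟩
    exact ⟨c + c', by simp [pnObs, add_smul, Finset.sum_add_distrib]⟩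
  · rintro t _ _ ⟨c, rfl⟩
    exact ⟨t • c, by simp [pnObs, mul_smul, Finset.smul_sum]⟩

/-- Forms of all weights can be given by one array of coefficients, since the weight is
determined by the exponents. -/
theorem exists_pnObs_forall_eq {f : ℕ → Obs} (hf : ∀ w, f w ∈ W ^ w) :
    ∃ c, ∀ w, pnObs w c = f w := by
  choose c hc using fun w => exists_pnObs_eq (hf w)
  refine ⟨fun l m n => c (l + m + n) l m n, fun w => ?_⟩
  rw [← hc w]
  refine Finset.sum_congr rfl fun a ha => Finset.sum_congr rfl fun b hb => ?_
  rw [Finset.HasAntidiagonal.mem_antidiagonal] at ha hb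
  simp only
  rw [show a.1 + b.1 + b.2 = w by omega]

/-- The coefficients of the Hamiltonian as observables. -/
def hamObs (c : ℕ → ℕ → ℕ → ℝ) : ℕ → Obs
  | 0 => E
  | j + 1 => pnObs (j + 2) c

theorem rep_pnHam (c : ℕ → ℕ → ℕ → ℝ) : ∀ k, Rep (pnHam c k) (hamObs c k)
  | 0 => rep_E
  | _ + 1 => rep_pnForm _ c

theorem hamObs_mem (c : ℕ → ℕ → ℕ → ℝ) : ∀ k, hamObs c k ∈ W ^ (k + 1)
  | 0 => by simpa [hamObs] using E_mem_W
  | _ + 1 => pnObs_mem _ c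

theorem rep_pnGenerator {a : ℕ → ℕ → ℕ → ℝ} (i : ℕ) :
    Rep (pnGenerator a i) (d * pnObs i a) := rep_d.mul (rep_pnForm i a)

theorem rep_pnVector (α β : ℕ → ℕ → ℕ → ℝ) (j : ℕ) (i : Fin 3) :
    Rep (pnVector α β j i) (pnObs j α * d * P i + pnObs (j + 1) β * Q i) :=
  (((rep_pnForm j α).mul rep_d).mul (rep_P i)).add ((rep_pnForm (j + 1) β).mul (rep_Q i))

theorem conservedUpTo_iff {N : ℕ} {c : ℕ → ℕ → ℕ → ℝ} {A : ℕ → Fin 3 → Pt → ℝ}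
    {a : ℕ → Fin 3 → Obs} (hA : ∀ j i, Rep (A j i) (a j i)) :
    ConservedUpTo N (pnHam c) A ↔
      ∀ k ≤ N, ∀ i, conv br (hamObs c) (fun j => a j i) k = 0 := by
  have key : ∀ k i, Rep (∑ j ∈ Finset.range (k + 1), pb (pnHam c j) (A (k - j) i))
      (conv br (hamObs c) (fun j => a j i) k) := by
    intro k i
    rw [conv, Finset.Nat.sum_antidiagonal_eq_sum_range_succ_mk]
    exact Rep.sum fun j _ => (rep_pnHam c j).pb (hA _ i)
  refine forall_congr' fun k => forall_congr' fun _ => forall_congr' fun i => ⟨fun h => ?_,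
    fun h x hx => ?_⟩
  · exact (key k i).eq_of_eqOn Rep.zero fun x hx => by simpa using h x hx
  · have := key k i
    rw [h] at this
    simpa using this.eqOn Rep.zero hx

theorem pnConjugateToKepler_iff {N : ℕ} {c : ℕ → ℕ → ℕ → ℝ} :
    PNConjugateToKepler N c ↔ ∃ (δ : ℕ → ℝ) (g : ℕ → Obs), δ 0 = 1 ∧ (∀ i, g i ∈ W ^ i) ∧
      ∀ k ≤ N, hamObs c k = chain (fun i => d * g i) N (rescaled δ) k := by
  constructor
  · rintro ⟨δ, a, hδ, h⟩
    exact ⟨δ, fun i => pnObs i a, hδ, fun i => pnObs_mem i a, fun k hk =>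
      (rep_pnHam c k).eq_of_eqOn (rep_lieChain rep_pnGenerator (rep_rescaled δ) N k) (h k hk)⟩
  · rintro ⟨δ, g, hδ, hg, h⟩
    obtain ⟨a, ha⟩ := exists_pnObs_forall_eq hg
    refine ⟨δ, a, hδ, fun k hk => ?_⟩
    have h1 := rep_lieChain (rep_pnGenerator (a := a)) (rep_rescaled δ) N k
    simp only [ha] at h1
    rw [← h k hk] at h1
    exact (rep_pnHam c k).eqOn h1

/-! ### The implications between the four conditions -/

/-- The pulled-back Laplace-Runge-Lenz vector is conserved. -/
theorem ConjugateToKepler.conservesLRL {N : ℕ} {c : ℕ → ℕ → ℕ → ℝ} (h : ConjugateToKepler N c) :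
    ConservesLRL N c := by
  obtain ⟨δ, T, -, hT, hH⟩ := h
  have hlrl := fun i => (rep_lrl i).1
  have hres := fun n => (rep_rescaled δ n).1
  have ha : ∀ j i, ∃ f, Rep (if j ≤ N then T j (lrl i) else 0) f := by
    intro j i
    split_ifs with hj
    · exact (hT.smooth j hj _ (hlrl i)).exists_obs
    · exact ⟨0, Rep.zero⟩
  have hb : ∀ j n, ∃ f, j ≤ N → Rep (T j (rescaledKepler δ n)) f := by
    intro j n
    by_cases hj : j ≤ N
    · obtain ⟨f, hf⟩ := (hT.smooth j hj _ (hres n)).exists_obs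
      exact ⟨f, fun _ => hf⟩
    · exact ⟨0, fun h => absurd h hj⟩
  choose a ha using ha
  choose b hb using hb
  refine ⟨fun j i => if j ≤ N then T j (lrl i) else 0, fun j i => (ha j i).1, fun i => ?_, ?_⟩
  · simpa using hT.near_id _ (hlrl i)
  rw [conservedUpTo_iff ha]
  intro k hk i
  have hham : ∀ j ≤ N, hamObs c j =
      ∑ p ∈ Finset.HasAntidiagonal.antidiagonal j, b p.2 p.1 := by
    intro j hj
    rw [Finset.Nat.sum_antidiagonal_eq_sum_range_succ_mk]
    exact (rep_pnHam c j).eq_of_eqOn (Rep.sum fun n _ => hb (j - n) n (by omega)) (hH j hj)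
  have hzero : ∀ q ≤ N, ∀ n,
      ∑ p ∈ Finset.HasAntidiagonal.antidiagonal q, br (b p.1 n) (a p.2 i) = 0 := by
    intro q hq n
    rw [Finset.Nat.sum_antidiagonal_eq_sum_range_succ_mk]
    refine Rep.eq_of_eqOn (Rep.sum fun j hj => ?_) Rep.zero
      (F := ∑ j ∈ Finset.range (q + 1), pb (T j (rescaledKepler δ n)) (T (q - j) (lrl i))) ?_
    · rw [Finset.mem_range] at hj
      have := ha (q - j) i
      rw [if_pos (by omega)] at this
      exact (hb j n (by omega)).pb this
    · intro x hx
      have h1 := (rep_rescaled δ n).pb (rep_lrl i)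
      rw [br_rescaled_lrlObs] at h1
      have h2 := hT.map_pb q hq _ _ (hres n) (hlrl i) hx
      have h3 := hT.congr q hq _ _ h1.1 Rep.zero.1 (h1.eqOn Rep.zero) hx
      have h4 := hT.map_smul q hq 0 0 Rep.zero.1 hx
      rw [smul_zero, zero_smul] at h4
      rw [← h2, h3, h4]
  rw [conv, Finset.sum_congr rfl fun p hp => ?_, sum_antidiagonal_assoc k
    fun n m l => br (b m n) (a l i)]
  · refine Finset.sum_eq_zero fun p hp => ?_
    rw [Finset.HasAntidiagonal.mem_antidiagonal] at hp
    exact hzero p.2 (by omega) p.1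
  · rw [Finset.HasAntidiagonal.mem_antidiagonal] at hp
    rw [hham p.1 (by omega), map_sum, LinearMap.sum_apply]

theorem ConservesLRL.pnConjugateToKepler {N : ℕ} {c : ℕ → ℕ → ℕ → ℝ} (h : ConservesLRL N c) :
    PNConjugateToKepler N c := by
  obtain ⟨A, hA, hA0, hcons⟩ := h
  choose a ha using fun j i => (hA j i).exists_obs
  rw [conservedUpTo_iff ha] at hcons
  exact pnConjugateToKepler_iff.mpr (exists_chain_of_conserved rfl (hamObs_mem c)
    ((ha 0 1).eq_of_eqOn (rep_lrl 1) (hA0 1)) N fun k hk => hcons k hk 1)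

theorem PNConjugateToKepler.conservesPNLRL {N : ℕ} {c : ℕ → ℕ → ℕ → ℝ}
    (h : PNConjugateToKepler N c) : ConservesPNLRL N c := by
  obtain ⟨δ, g, -, hg, hH⟩ := pnConjugateToKepler_iff.mp h
  set Φ := chain (fun i => d * g i) N with hΦ
  let L : ℕ → Fin 3 → Obs := Pi.single 0 lrlObs
  have hL : ∀ k, L k ∈ V k := by
    intro k
    rcases k with _ | k
    · exact lrlObs_mem_V
    · simp [L]
  choose a ha b hb hab using fun k => chain_mem_V hg hL N k
  obtain ⟨α, hα⟩ := exists_pnObs_forall_eq ha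
  obtain ⟨β, hβ⟩ := exists_pnObs_forall_eq (f := fun w => if w = 0 then 0 else b (w - 1)) (by
    intro w
    rcases w with _ | w
    · simp
    · simpa using hb w)
  have hrep : ∀ j i, Rep (pnVector α β j i) (Φ (fun k => L k i) j) := by
    intro j i
    have := rep_pnVector α β j i
    rw [hα, hβ] at this
    have hj : Φ (fun k => L k i) j = _ := hab j i
    rw [hj]
    simpa using this
  refine ⟨α, β, fun i => ?_, ?_⟩
  · have h0 := (unitriangular_chain (fun i => d * g i) N (fun k => L k i) 0 (by simp)).2
    have := hrep 0 i
    rw [h0] at this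
    exact this.eqOn (rep_lrl i)
  · rw [conservedUpTo_iff hrep]
    intro k hk i
    have h1 : conv br (hamObs c) (Φ fun k => L k i) k =
        Φ (conv br (rescaled δ) fun k => L k i) k := by
      rw [chain_conv _ br_jacobi]
      refine Finset.sum_congr rfl fun p hp => ?_
      rw [Finset.HasAntidiagonal.mem_antidiagonal] at hp
      rw [hH p.1 (by omega)]
    have h2 : (conv br (rescaled δ) fun k => L k i) = 0 := by
      ext1 k
      refine Finset.sum_eq_zero fun p _ => ?_
      rcases p.2 with _ | m
      · exact br_rescaled_lrlObs δ p.1 i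
      · simp [L]
    exact h1.trans (by rw [h2, map_zero]; rfl)

theorem ConservesPNLRL.conservesLRL {N : ℕ} {c : ℕ → ℕ → ℕ → ℝ} (h : ConservesPNLRL N c) :
    ConservesLRL N c := by
  obtain ⟨α, β, h0, hcons⟩ := h
  exact ⟨pnVector α β, fun j i => (rep_pnVector α β j i).1, h0, hcons⟩

/-- A chain of Lie transforms is a canonical transformation. -/
theorem PNConjugateToKepler.conjugateToKepler {N : ℕ} {c : ℕ → ℕ → ℕ → ℝ}
    (h : PNConjugateToKepler N c) : ConjugateToKepler N c := by
  classical
  obtain ⟨δ, g, hδ, hg, hH⟩ := pnConjugateToKepler_iff.mp h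
  set Φ := chain (fun i => d * g i) N with hΦ
  -- `T k F` is the coefficient of `ε ^ k` in `Φ F`; its values at functions which are not smooth
  -- on the phase space play no role.
  have hexists : ∀ (k : ℕ) (F : Pt → ℝ), ∃ F' : Pt → ℝ,
      ∀ f, Rep F f → Rep F' (Φ (Pi.single 0 f) k) := by
    intro k F
    by_cases hF : SmoothObs F
    · obtain ⟨f, hf⟩ := hF.exists_obs
      obtain ⟨F', hF'⟩ := exists_rep (Φ (Pi.single 0 f) k)
      exact ⟨F', fun f' hf' => by rwa [hf'.eq_of_eqOn hf (Set.eqOn_refl _ _)]⟩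
    · exact ⟨0, fun f hf => absurd hf.1 hF⟩
  choose T hT using hexists
  have hconv : ∀ (B : Obs →ₗ[ℝ] Obs →ₗ[ℝ] Obs),
      (∀ g f f', br g (B f f') = B (br g f) f' + B f (br g f')) → ∀ (k : ℕ) (f f' : Obs),
      Φ (Pi.single 0 (B f f')) k =
        ∑ j ∈ Finset.range (k + 1), B (Φ (Pi.single 0 f) j) (Φ (Pi.single 0 f') (k - j)) := by
    intro B hB k f f'
    have : (Pi.single 0 (B f f') : ℕ → Obs) = conv B (Pi.single 0 f) (Pi.single 0 f') := by
      ext1 n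
      rcases n with _ | n
      · simp [conv]
      · rw [Pi.single_eq_of_ne (by omega)]
        refine (Finset.sum_eq_zero fun p hp => ?_).symm
        rw [Finset.HasAntidiagonal.mem_antidiagonal] at hp
        rcases eq_or_ne p.1 0 with h0 | h0
        · rw [Pi.single_eq_of_ne (show p.2 ≠ 0 by omega), map_zero]
        · rw [Pi.single_eq_of_ne h0, map_zero, LinearMap.zero_apply]
    rw [this, chain_conv _ hB, conv, Finset.Nat.sum_antidiagonal_eq_sum_range_succ_mk]
  refine ⟨δ, T, hδ, ?_, fun k hk => ?_⟩
  · constructor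
    · intro k _ F hF
      obtain ⟨f, hf⟩ := hF.exists_obs
      exact (hT k F f hf).1
    · intro k _ F G hF hG hFG
      obtain ⟨f, hf⟩ := hF.exists_obs
      exact (hT k F f hf).eqOn (hT k G f (hf.congr hFG.symm))
    · intro F hF
      obtain ⟨f, hf⟩ := hF.exists_obs
      have h0 := hT 0 F f hf
      rw [(unitriangular_chain _ N (Pi.single 0 f) 0 (by simp)).2] at h0
      exact h0.eqOn hf
    · intro k _ F G hF hG
      obtain ⟨f, hf⟩ := hF.exists_obs
      obtain ⟨f', hf'⟩ := hG.exists_obs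
      have h1 := hT k _ _ (hf.add hf')
      rw [Pi.single_add, map_add] at h1
      exact h1.eqOn ((hT k _ _ hf).add (hT k _ _ hf'))
    · intro k _ t F hF
      obtain ⟨f, hf⟩ := hF.exists_obs
      have h1 := hT k _ _ (hf.smul t)
      rw [Pi.single_smul, map_smul] at h1
      exact h1.eqOn ((hT k _ _ hf).smul t)
    · intro k _ F G hF hG
      obtain ⟨f, hf⟩ := hF.exists_obs
      obtain ⟨f', hf'⟩ := hG.exists_obs
      have h1 := hT k _ _ (hf.mul hf')
      have h2 := hconv (LinearMap.mul ℝ Obs) (fun g f f' => br_mul g f f') k f f'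
      simp only [LinearMap.mul_apply'] at h2
      rw [h2] at h1
      exact h1.eqOn (Rep.sum fun j _ => (hT j _ _ hf).mul (hT _ _ _ hf'))
    · intro k _ F G hF hG
      obtain ⟨f, hf⟩ := hF.exists_obs
      obtain ⟨f', hf'⟩ := hG.exists_obs
      have h1 := hT k _ _ (hf.pb hf')
      rw [hconv br br_jacobi] at h1
      exact h1.eqOn (Rep.sum fun j _ => (hT j _ _ hf).pb (hT _ _ _ hf'))
  · have h1 := rep_pnHam c k
    rw [hH k hk, epsLinear_chain _ N, Finset.Nat.sum_antidiagonal_eq_sum_range_succ_mk] at h1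
    exact h1.eqOn (Rep.sum fun n _ => hT _ _ _ (rep_rescaled δ n))

end PNKepler

end

theorem mainTheorem5 (c : ℕ → ℕ → ℕ → ℝ) (N : ℕ) (hN : N ≤ 5) :
    (PNKepler.ConjugateToKepler N c ↔ PNKepler.ConservesLRL N c) ∧
      (PNKepler.ConjugateToKepler N c ↔ PNKepler.PNConjugateToKepler N c) ∧
      (PNKepler.ConservesLRL N c ↔ PNKepler.ConservesPNLRL N c) :=
  ⟨⟨fun h => h.conservesLRL, fun h => h.pnConjugateToKepler.conjugateToKepler⟩,
    ⟨fun h => h.conservesLRL.pnConjugateToKepler, fun h => h.conjugateToKepler⟩,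
    ⟨fun h => h.pnConjugateToKepler.conservesPNLRL, fun h => h.conservesLRL⟩⟩
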